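/- Fix a real number $\beta>0$, a real number $d>0$, and a probability distribution $\zeta$ on $\mathbb{Z}_{\ge 0}$ with expectation $d$ and finite second moment. Let $\mathbf{T}$ be the Galton–Watson tree with offspring distribution $\zeta$ and root $r$ (each vertex has, independently of the others, a random number of children with law $\zeta$). Given $\mathbf{T}$, let the couplings $\mathbf{J}_e$ of the edges $e$ of $\mathbf{T}$ be i.i.d. standard Gaussians, and let $\boldsymbol{\mu}_\beta$ be the Edwards–Anderson model on $\mathbf{T}$, i.e. the random (free-boundary) Gibbs distribution on spin configurations with values in $\{\pm1\}$, $$\boldsymbol{\mu}_\beta(\sigma)\propto\exp\Big(\beta\sum_{\{u,w\}}\mathbf{1}\{\sigma(u)=\sigma(w)\}\,\mathbf{J}_{\{u,w\}}\Big),$$ where the sum is over the edges of $\mathbf{T}$. Its marginal $\boldsymbol{\mu}_h$ on the vertices at distance $h$ from $r$ is computed on $\mathbf{T}$ cut at any height $H\ge h$, and does not depend on $H$. One says that $\boldsymbol{\mu}_\beta$ exhibits reconstruction if $$\limsup_{h\to\infty}\ \mathbb{E}_{\mathbf{T}}\Big[\mathbb{E}_{\mathbf{J}}\big[\,\|\boldsymbol{\mu}_h(\cdot\mid\sigma(r)=+1)-\boldsymbol{\mu}_h(\cdot\mid\sigma(r)=-1)\|_{\rm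 TV}\ \big|\ \mathbf{T}\big]\Big]>0,$$ and non-reconstruction if this upper limit is $0$ (the total variation distance is $0$ if $\mathbf{T}$ has no vertex at distance $h$). Let $$\Delta_{\rm EA}(\beta)=\left(\mathbb{E}\left[\left(\frac{1-\exp(\beta \mathbf{J})}{1+\exp(\beta \mathbf{J})}\right)^2\right]\right)^{-1},\qquad \mathbf{J}\sim\mathcal{N}(0,1).$$ Then $\boldsymbol{\mu}_\beta$ exhibits reconstruction if $d>\Delta_{\rm EA}(\beta)$, and non-reconstruction if $d<\Delta_{\rm EA}(\beta)$. -/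

import Mathlib

open MeasureTheory ProbabilityTheory Filter

/-! The Edwards-Anderson model on Galton-Watson trees.

Vertices are Ulam-Harris words: the root is `[]`, and the children of `u` are `0 :: u`, `1 :: u`,
and so on up to the number of children of `u`.  An edge is labelled by its lower endpoint. -/

namespace EAModel

/-- The vertices at distance `h` from the root in the tree in which `u` has `N u` children. -/
def level (N : List ℕ → ℕ) : ℕ → Finset (List ℕ)
  | 0 => {[]}
  | h + 1 => (level N h).biUnion fun u => (Finset.range (N u)).image fun i => i :: u

/-- The vertices at distance at most `H` from the root. -/
def ball (N : List ℕ → ℕ) (H : ℕ) : Finset (List ℕ) :=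
  (Finset.range (H + 1)).biUnion (level N)

theorem level_subset_ball (N : List ℕ → ℕ) {h H : ℕ} (hH : h ≤ H) : level N h ⊆ ball N H := by
  intro v hv
  exact Finset.mem_biUnion.2 ⟨h, Finset.mem_range.2 (by omega), hv⟩

theorem nil_mem_ball (N : List ℕ → ℕ) (H : ℕ) : ([] : List ℕ) ∈ ball N H :=
  level_subset_ball N (Nat.zero_le H) (by simp [level])

/-- Configurations of spins `1`, `-1` on a finite set of vertices. -/
abbrev Config (V : Finset (List ℕ)) : Type := V → ℤˣ

/-- The edges spanned by `V`, as pairs (parent, child). -/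
def edges (V : Finset (List ℕ)) : Finset (V × V) :=
  Finset.univ.filter fun e => e.2.1 ≠ [] ∧ e.2.1.tail = e.1.1

/-- The weight `exp (β ∑ 1{σ(u) = σ(w)} J_{u,w})`, the sum running over the edges spanned
by `V`; the coupling of the edge between `v` and its parent is `J v`. -/
noncomputable def weight (β : ℝ) (J : List ℕ → ℝ) (V : Finset (List ℕ)) (σ : Config V) : ℝ :=
  Real.exp (β * ∑ e ∈ edges V, if σ e.1 = σ e.2 then J e.2 else 0)

/-- The Gibbs distribution on the configurations on `V`. -/
noncomputable def gibbs (β : ℝ) (J : List ℕ → ℝ) (V : Finset (List ℕ)) (σ : Config V) : ℝ :=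
  weight β J V σ / ∑ τ : Config V, weight β J V τ

/-- The spin of the root. -/
def rootSpin {N : List ℕ → ℕ} {H : ℕ} (σ : Config (ball N H)) : ℤˣ := σ ⟨[], nil_mem_ball N H⟩

/-- The spins at distance `h` from the root. -/
def levelSpins {N : List ℕ → ℕ} {h H : ℕ} (hH : h ≤ H) (σ : Config (ball N H)) :
    Config (level N h) :=
  fun v => σ ⟨v.1, level_subset_ball N hH v.2⟩

/-- The probability of the configuration `η` at distance `h` from the root, conditional on the root
having spin `s`, under the Gibbs distribution on the tree cut at height `H ≥ h`.  It does not
depend on `H` (see `levelLaw_eq`), so that it is the conditional marginal of the Gibbs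
distribution on the whole tree. -/
noncomputable def levelLaw (β : ℝ) (N : List ℕ → ℕ) (J : List ℕ → ℝ) {h H : ℕ} (hH : h ≤ H)
    (s : ℤˣ) (η : Config (level N h)) : ℝ :=
  (∑ σ : Config (ball N H) with rootSpin σ = s ∧ levelSpins hH σ = η, gibbs β J (ball N H) σ) /
    ∑ σ : Config (ball N H) with rootSpin σ = s, gibbs β J (ball N H) σ

theorem level_length (N : List ℕ → ℕ) {h : ℕ} {v : List ℕ} (hv : v ∈ level N h) :
    v.length = h := by
  induction h generalizing v with
  | zero => simp [level] at hv; simp [hv]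
  | succ h ih =>
    simp only [level, Finset.mem_biUnion, Finset.mem_image] at hv
    obtain ⟨u, hu, i, -, rfl⟩ := hv
    simp [ih hu]

theorem ball_length (N : List ℕ → ℕ) {H : ℕ} {v : List ℕ} (hv : v ∈ ball N H) :
    v.length ≤ H := by
  simp only [ball, Finset.mem_biUnion, Finset.mem_range] at hv
  obtain ⟨h, hh, hv⟩ := hv
  have := level_length N hv
  omega

theorem level_succ_tail (N : List ℕ → ℕ) {h : ℕ} {v : List ℕ} (hv : v ∈ level N (h + 1)) :
    v ≠ [] ∧ v.tail ∈ level N h := by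
  simp only [level, Finset.mem_biUnion, Finset.mem_image] at hv
  obtain ⟨u, hu, i, -, rfl⟩ := hv
  exact ⟨by simp, by simpa using hu⟩

theorem ball_succ (N : List ℕ → ℕ) (H : ℕ) : ball N (H + 1) = ball N H ∪ level N (H + 1) := by
  simp only [ball]
  rw [Finset.range_add_one (n := H + 1), Finset.biUnion_insert, Finset.union_comm]

theorem sum_edges (V : Finset (List ℕ)) (J : List ℕ → ℝ) (s : List ℕ → ℤˣ) :
    (∑ e ∈ edges V, if s e.1 = s e.2 then J e.2 else 0) =
      ∑ v ∈ V, ∑ u ∈ V, if (v ≠ [] ∧ v.tail = u) ∧ s u = s v then J v else 0 := by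
  have h1 : ∀ v, (∑ u ∈ V, if (v ≠ [] ∧ v.tail = u) ∧ s u = s v then J v else 0) =
      ∑ u : V, if (v ≠ [] ∧ v.tail = u) ∧ s u = s v then J v else 0 :=
    fun v => (Finset.sum_coe_sort V _).symm
  simp only [h1]
  rw [← Finset.sum_coe_sort V, Finset.sum_comm, edges, Finset.sum_filter, Fintype.sum_prod_type]
  refine Finset.sum_congr rfl fun u _ => Finset.sum_congr rfl fun v _ => ?_
  simp only [ite_and]

/-- Adding a layer of leaves multiplies the sums over configurations by a constant. -/
theorem exists_sum_weight (β : ℝ) (J : List ℕ → ℝ) (V L W : Finset (List ℕ)) (hW : W = V ∪ L)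
    (hVL : Disjoint V L) (hL : ∀ l ∈ L, l ≠ [] ∧ l.tail ∈ V)
    (hV : ∀ v ∈ W, v.tail ∉ L) (hsub : V ⊆ W) :
    ∃ C : ℝ, 0 < C ∧ ∀ F : Config V → ℝ,
      ∑ σ : Config W, weight β J W σ * F (fun v => σ ⟨v.1, hsub v.2⟩) =
        C * ∑ τ : Config V, weight β J V τ * F τ := by
  subst hW
  let g : ℤˣ → (l : L) → ℤˣ → ℝ := fun a l b => Real.exp (β * if a = b then J l else 0)
  refine ⟨∏ l : L, (Real.exp (β * J l) + 1), Finset.prod_pos fun l _ => by positivity, ?_⟩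
  intro F
  have key : ∀ (τ : Config V) (ρ : Config L),
      weight β J (V ∪ L) (Equiv.piFinsetUnion (fun _ => ℤˣ) hVL (τ, ρ)) =
        weight β J V τ * ∏ l : L, g (τ ⟨l.1.tail, (hL l l.2).2⟩) l (ρ l) := by
    intro τ ρ
    let s : List ℕ → ℤˣ := fun x =>
      if hx : x ∈ V then τ ⟨x, hx⟩ else if hx' : x ∈ L then ρ ⟨x, hx'⟩ else 1
    have hsV : ∀ v : V, τ v = s v := fun v => by simp [s]
    have hsL : ∀ l : L, ρ l = s l := fun l => by
      have : (l : List ℕ) ∉ V := fun h => Finset.disjoint_left.1 hVL h l.2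
      simp [s, this]
    have hsW : ∀ w : (V ∪ L : Finset (List ℕ)),
        Equiv.piFinsetUnion (fun _ => ℤˣ) hVL (τ, ρ) w = s w := by
      rintro ⟨w, hw⟩
      rcases Finset.mem_union.1 hw with h | h
      · rw [Equiv.piFinsetUnion_left (fun _ => ℤˣ) hVL h]; exact hsV ⟨w, h⟩
      · rw [Equiv.piFinsetUnion_right (fun _ => ℤˣ) hVL h]; exact hsL ⟨w, h⟩
    simp only [weight, g, hsW, hsV, hsL, sum_edges]
    rw [← Real.exp_sum, ← Real.exp_add, ← Finset.mul_sum, ← mul_add]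
    congr 2
    have hin : ∀ v ∈ V ∪ L, (∑ u ∈ V ∪ L, if (v ≠ [] ∧ v.tail = u) ∧ s u = s v then J v else 0) =
        ∑ u ∈ V, if (v ≠ [] ∧ v.tail = u) ∧ s u = s v then J v else 0 := by
      intro v hv
      rw [Finset.sum_union hVL, add_eq_left]
      refine Finset.sum_eq_zero fun u hu => if_neg ?_
      rintro ⟨⟨-, rfl⟩, -⟩
      exact hV v hv hu
    rw [Finset.sum_congr rfl hin, Finset.sum_union hVL, ← Finset.sum_coe_sort L]
    congr 1
    refine Finset.sum_congr rfl fun l _ => ?_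
    rw [Finset.sum_eq_single_of_mem l.1.tail (hL l l.2).2]
    · simp [(hL l l.2).1]
    · intro u _ hu
      exact if_neg fun h => hu h.1.2.symm
  have hg : ∀ (a : ℤˣ) (l : L), ∑ b : ℤˣ, g a l b = Real.exp (β * J l) + 1 := by
    intro a l
    rcases Int.units_eq_one_or a with rfl | rfl <;>
      simp [g, add_comm]
  rw [← (Equiv.piFinsetUnion (fun _ => ℤˣ) hVL).sum_comp, Fintype.sum_prod_type, Finset.mul_sum]
  refine Finset.sum_congr rfl fun τ _ => ?_
  have hr : ∀ ρ : Config L, (fun v : V =>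
      Equiv.piFinsetUnion (fun _ => ℤˣ) hVL (τ, ρ) ⟨v.1, hsub v.2⟩) = τ := by
    intro ρ
    funext v
    exact Equiv.piFinsetUnion_left (fun _ => ℤˣ) hVL v.2 _
  simp only [key, hr]
  have hp : ∑ ρ : Config L, ∏ l : L, g (τ ⟨l.1.tail, (hL l l.2).2⟩) l (ρ l) =
      ∏ l : L, (Real.exp (β * J l) + 1) := by
    have := Finset.prod_univ_sum (fun _ : L => (Finset.univ : Finset ℤˣ))
      (fun l b => g (τ ⟨l.1.tail, (hL l l.2).2⟩) l b)
    rw [Fintype.piFinset_univ] at this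
    rw [← this]
    exact Finset.prod_congr rfl fun l _ => hg _ l
  rw [← Finset.sum_mul, ← Finset.mul_sum, hp]
  ring

/-- The conditional marginals at distance `h` from the root do not depend on the height at which
the tree is cut. -/
theorem levelLaw_eq (β : ℝ) (N : List ℕ → ℕ) (J : List ℕ → ℝ) {h H : ℕ} (hH : h ≤ H) (s : ℤˣ)
    (η : Config (level N h)) : levelLaw β N J hH s η = levelLaw β N J (le_refl h) s η := by
  induction H, hH using Nat.le_induction with
  | base => rfl
  | succ H hH ih =>
    rw [← ih]
    have hdisj : Disjoint (ball N H) (level N (H + 1)) := Finset.disjoint_left.2 fun v h1 h2 => by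
      have := ball_length N h1
      have := level_length N h2
      omega
    have htail : ∀ v ∈ ball N (H + 1), v.tail ∉ level N (H + 1) := fun v h1 h2 => by
      have := ball_length N h1
      have := level_length N h2
      simp at this
      omega
    have hsub : ball N H ⊆ ball N (H + 1) := by
      rw [ball_succ]; exact Finset.subset_union_left
    obtain ⟨C, hC, key⟩ := exists_sum_weight β J (ball N H) (level N (H + 1)) (ball N (H + 1))
      (ball_succ N H) hdisj
      (fun l hl => ⟨(level_succ_tail N hl).1,
        level_subset_ball N (le_refl H) (level_succ_tail N hl).2⟩) htail hsub
    have hZ : ∀ K, 0 < ∑ τ : Config (ball N K), weight β J (ball N K) τ := fun K =>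
      Finset.sum_pos (fun _ _ => Real.exp_pos _) Finset.univ_nonempty
    have red : ∀ (K : ℕ) (hK : h ≤ K), levelLaw β N J hK s η =
        (∑ σ : Config (ball N K), weight β J (ball N K) σ *
          if rootSpin σ = s ∧ levelSpins hK σ = η then 1 else 0) /
        ∑ σ : Config (ball N K), weight β J (ball N K) σ * if rootSpin σ = s then 1 else 0 := by
      intro K hK
      simp only [levelLaw, gibbs, ← Finset.sum_div, mul_ite, mul_one, mul_zero,
        ← Finset.sum_filter]
      rw [div_div_div_cancel_right₀ (hZ K).ne']
    rw [red, red]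
    have h1 := key fun τ => if rootSpin τ = s ∧ levelSpins hH τ = η then 1 else 0
    have h2 := key fun τ => if rootSpin τ = s then 1 else 0
    symm
    rw [← mul_div_mul_left _ _ hC.ne', ← h1, ← h2]
    rfl

/-- The total variation distance of the laws of the configuration at distance `h` from the root,
conditional on the root having spin `1` and `-1`. -/
noncomputable def tvDist (β : ℝ) (N : List ℕ → ℕ) (J : List ℕ → ℝ) (h : ℕ) : ℝ :=
  (1 / 2) * ∑ η : Config (level N h),
    |levelLaw β N J (le_refl h) 1 η - levelLaw β N J (le_refl h) (-1) η|

/-- The expected total variation distance at distance `h` from the root: the numbers of children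
of the vertices are i.i.d. with law `ζ`, and, given the tree, the couplings are i.i.d. standard
Gaussians. -/
noncomputable def expectedTV (β : ℝ) (ζ : PMF ℕ) (h : ℕ) : ENNReal :=
  ∫⁻ N : List ℕ → ℕ, ∫⁻ J : List ℕ → ℝ, ENNReal.ofReal (tvDist β N J h)
    ∂(Measure.infinitePi fun _ : List ℕ => gaussianReal 0 1)
    ∂(Measure.infinitePi fun _ : List ℕ => ζ.toMeasure)

/-- The Edwards-Anderson model on the Galton-Watson tree exhibits reconstruction. -/
def Reconstruction (β : ℝ) (ζ : PMF ℕ) : Prop :=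
  0 < limsup (expectedTV β ζ) atTop

/-- The Edwards-Anderson model on the Galton-Watson tree exhibits non-reconstruction. -/
def NonReconstruction (β : ℝ) (ζ : PMF ℕ) : Prop :=
  limsup (expectedTV β ζ) atTop = 0

/-- The threshold `Δ_EA(β)`. -/
noncomputable def deltaEA (β : ℝ) : ℝ :=
  (∫ x, ((1 - Real.exp (β * x)) / (1 + Real.exp (β * x))) ^ 2 ∂(gaussianReal 0 1))⁻¹

end EAModel

/-! This is a Kesten–Stigum threshold. Given the couplings, a spin passes along an edge through a
symmetric binary channel with correlation `theta (β * J)`. The mean square of this correlation is λ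
= 1/Δ_EA, so the quantity that matters is m = dλ, the growth factor per generation of the expected
sum of squared correlations with the root.

Below the threshold information is lost. Relative to uniform spins, the spins at distance h have
density p + q or p - q according to the root spin, with p even and q odd under a global flip, and
the total variation distance is the mean of |q|. The divergence, the mean of q²/p, is multiplied by
the squared correlation along an edge and is subadditive when independent subtrees are joined at a
vertex (`IsSymPair.signMean_div_le`). It is therefore at most the sum of the squared correlations
between the root and the vertices at distance h (`isSymPair_density`). That sum has expectation m^h,
and `tvDist_le` passes from the divergence to total variation.

Above the threshold the root is estimated by the sum of the spins at distance h, each weighted by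
its correlation with the root. Its conditional mean is ±Z and its conditional second moment is W for
either root spin, whence 2tZ ≤ TV + t²W for every real t (`le_tvDist`). With these weights Z and W
are sums of products of squared edge correlations, so averaging over the couplings leaves powers of
λ. The expectation of Z is m^h. The recursion `secondSum_succ_le`, where the second moment of the
offspring law enters, bounds that of W by a constant times m^(2h) when m > 1. Taking t of order
m^(-h) keeps TV away from zero.

Both comparisons are linear in the random sums, so they can be averaged over couplings and trees
directly, without concentration estimates. -/

namespace EAModel

/-! ### Summing out the leaves -/

/-- The correlation of two neighbouring spins whose coupling, times `β`, is `t`. -/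
noncomputable def theta (t : ℝ) : ℝ := (Real.exp t - 1) / (Real.exp t + 1)

/-- The spin of `v` as a real number, with the value `0` if `v` is not in `V`. -/
noncomputable def spin {V : Finset (List ℕ)} (σ : Config V) (v : List ℕ) : ℝ :=
  if h : v ∈ V then ((σ ⟨v, h⟩ : ℤ) : ℝ) else 0

theorem spin_of_mem {V : Finset (List ℕ)} (σ : Config V) {v : List ℕ} (h : v ∈ V) :
    spin σ v = ((σ ⟨v, h⟩ : ℤ) : ℝ) := dif_pos h

theorem spin_sq {V : Finset (List ℕ)} (σ : Config V) {v : List ℕ} (h : v ∈ V) :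
    spin σ v * spin σ v = 1 := by
  rw [spin_of_mem σ h]
  rcases Int.units_eq_one_or (σ ⟨v, h⟩) with h | h <;> simp [h]

/-- Summing out a layer of leaves in a product of affine functions of their spins. -/
theorem exists_sum_weight_mul_prod (β : ℝ) (J : List ℕ → ℝ) (V L W : Finset (List ℕ))
    (hW : W = V ∪ L) (hVL : Disjoint V L) (hL : ∀ l ∈ L, l ≠ [] ∧ l.tail ∈ V)
    (hV : ∀ v ∈ W, v.tail ∉ L) (hsub : V ⊆ W) :
    ∃ C : ℝ, 0 < C ∧ ∀ (F : Config V → ℝ) (a b : List ℕ → ℝ),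
      ∑ σ : Config W, weight β J W σ * (F (fun v => σ ⟨v.1, hsub v.2⟩) *
        ∏ l ∈ L, (a l + b l * spin σ l)) =
        C * ∑ τ : Config V, weight β J V τ * (F τ *
          ∏ l ∈ L, (a l + b l * theta (β * J l) * spin τ l.tail)) := by
  subst hW
  let g : ℤˣ → (l : L) → ℤˣ → ℝ := fun a l b => Real.exp (β * if a = b then J l else 0)
  refine ⟨∏ l : L, (Real.exp (β * J l) + 1), Finset.prod_pos fun l _ => by positivity, ?_⟩
  intro F a b
  have key : ∀ (τ : Config V) (ρ : Config L),
      weight β J (V ∪ L) (Equiv.piFinsetUnion (fun _ => ℤˣ) hVL (τ, ρ)) =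
        weight β J V τ * ∏ l : L, g (τ ⟨l.1.tail, (hL l l.2).2⟩) l (ρ l) := by
    intro τ ρ
    let s : List ℕ → ℤˣ := fun x =>
      if hx : x ∈ V then τ ⟨x, hx⟩ else if hx' : x ∈ L then ρ ⟨x, hx'⟩ else 1
    have hsV : ∀ v : V, τ v = s v := fun v => by simp [s]
    have hsL : ∀ l : L, ρ l = s l := fun l => by
      have : (l : List ℕ) ∉ V := fun h => Finset.disjoint_left.1 hVL h l.2
      simp [s, this]
    have hsW : ∀ w : (V ∪ L : Finset (List ℕ)),
        Equiv.piFinsetUnion (fun _ => ℤˣ) hVL (τ, ρ) w = s w := by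
      rintro ⟨w, hw⟩
      rcases Finset.mem_union.1 hw with h | h
      · rw [Equiv.piFinsetUnion_left (fun _ => ℤˣ) hVL h]; exact hsV ⟨w, h⟩
      · rw [Equiv.piFinsetUnion_right (fun _ => ℤˣ) hVL h]; exact hsL ⟨w, h⟩
    simp only [weight, g, hsW, hsV, hsL, sum_edges]
    rw [← Real.exp_sum, ← Real.exp_add, ← Finset.mul_sum, ← mul_add]
    congr 2
    have hin : ∀ v ∈ V ∪ L, (∑ u ∈ V ∪ L, if (v ≠ [] ∧ v.tail = u) ∧ s u = s v then J v else 0) =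
        ∑ u ∈ V, if (v ≠ [] ∧ v.tail = u) ∧ s u = s v then J v else 0 := by
      intro v hv
      rw [Finset.sum_union hVL, add_eq_left]
      refine Finset.sum_eq_zero fun u hu => if_neg ?_
      rintro ⟨⟨-, rfl⟩, -⟩
      exact hV v hv hu
    rw [Finset.sum_congr rfl hin, Finset.sum_union hVL, ← Finset.sum_coe_sort L]
    congr 1
    refine Finset.sum_congr rfl fun l _ => ?_
    rw [Finset.sum_eq_single_of_mem l.1.tail (hL l l.2).2]
    · simp [(hL l l.2).1]
    · intro u _ hu
      exact if_neg fun h => hu h.1.2.symm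
  -- The channel of one edge: averaging an affine function of a leaf spin gives an affine function
  -- of the parent spin, with slope multiplied by `theta`.
  have hg : ∀ (c : ℤˣ) (l : L), ∑ e : ℤˣ, g c l e * (a l + b l * ((e : ℤ) : ℝ)) =
      (Real.exp (β * J l) + 1) * (a l + b l * theta (β * J l) * ((c : ℤ) : ℝ)) := by
    intro c l
    have hne : Real.exp (β * J l) + 1 ≠ 0 := by positivity
    have h2 : (-1 : ℤˣ) ≠ 1 := by decide
    rcases Int.units_eq_one_or c with rfl | rfl <;>
    · simp [g, theta]
      field_simp
      ring
  rw [← (Equiv.piFinsetUnion (fun _ => ℤˣ) hVL).sum_comp, Fintype.sum_prod_type, Finset.mul_sum]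
  refine Finset.sum_congr rfl fun τ _ => ?_
  have hr : ∀ ρ : Config L, (fun v : V =>
      Equiv.piFinsetUnion (fun _ => ℤˣ) hVL (τ, ρ) ⟨v.1, hsub v.2⟩) = τ := by
    intro ρ
    funext v
    exact Equiv.piFinsetUnion_left (fun _ => ℤˣ) hVL v.2 _
  have hl : ∀ ρ : Config L, ∏ l ∈ L, (a l + b l *
      spin (Equiv.piFinsetUnion (fun _ => ℤˣ) hVL (τ, ρ)) l) =
        ∏ l : L, (a l + b l * ((ρ l : ℤ) : ℝ)) := by
    intro ρ
    rw [← Finset.prod_coe_sort L]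
    refine Finset.prod_congr rfl fun l _ => ?_
    rw [spin_of_mem _ (Finset.mem_union_right V l.2),
      Equiv.piFinsetUnion_right (fun _ => ℤˣ) hVL l.2]
  simp only [key, hr, hl]
  have hp : ∑ ρ : Config L, ∏ l : L, (g (τ ⟨l.1.tail, (hL l l.2).2⟩) l (ρ l) *
        (a l + b l * ((ρ l : ℤ) : ℝ))) =
      (∏ l : L, (Real.exp (β * J l) + 1)) *
        ∏ l ∈ L, (a l + b l * theta (β * J l) * spin τ l.tail) := by
    have := Finset.prod_univ_sum (fun _ : L => (Finset.univ : Finset ℤˣ))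
      (fun l e => g (τ ⟨l.1.tail, (hL l l.2).2⟩) l e * (a l + b l * ((e : ℤ) : ℝ)))
    rw [Fintype.piFinset_univ] at this
    rw [← this, ← Finset.prod_coe_sort L (fun l => a l + b l * theta (β * J l) * spin τ l.tail),
      ← Finset.prod_mul_distrib]
    refine Finset.prod_congr rfl fun l _ => ?_
    rw [hg, spin_of_mem τ (hL l l.2).2]
  calc ∑ ρ : Config L, weight β J V τ * (∏ l : L, g (τ ⟨l.1.tail, (hL l l.2).2⟩) l (ρ l)) *
        (F τ * ∏ l : L, (a l + b l * ((ρ l : ℤ) : ℝ)))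
      = ∑ ρ : Config L, weight β J V τ * F τ * ∏ l : L, (g (τ ⟨l.1.tail, (hL l l.2).2⟩) l (ρ l) *
        (a l + b l * ((ρ l : ℤ) : ℝ))) := by
        refine Finset.sum_congr rfl fun ρ _ => ?_
        rw [Finset.prod_mul_distrib]; ring
    _ = _ := by rw [← Finset.mul_sum, hp]; ring

/-! ### Conditional expectations given the root spin -/

/-- The expectation, conditional on the root having spin `s`, under the Gibbs distribution on the
tree cut at height `h`. -/
noncomputable def rootMean (β : ℝ) (N : List ℕ → ℕ) (J : List ℕ → ℝ) (h : ℕ) (s : ℤˣ)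
    (F : Config (ball N h) → ℝ) : ℝ :=
  (∑ σ : Config (ball N h), weight β J (ball N h) σ * ((if rootSpin σ = s then 1 else 0) * F σ)) /
    ∑ σ : Config (ball N h), weight β J (ball N h) σ * if rootSpin σ = s then 1 else 0

section rootMean

variable (β : ℝ) (N : List ℕ → ℕ) (J : List ℕ → ℝ) (h : ℕ) (s : ℤˣ)

theorem sum_weight_root_pos :
    0 < ∑ σ : Config (ball N h), weight β J (ball N h) σ * if rootSpin σ = s then 1 else 0 := by
  refine Finset.sum_pos' (fun σ _ => mul_nonneg (Real.exp_pos _).le (by split_ifs <;> simp))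
    ⟨fun _ => s, Finset.mem_univ _, ?_⟩
  simp only [rootSpin, if_true, mul_one]
  exact Real.exp_pos _

theorem rootMean_sum {ι : Type*} (S : Finset ι) (F : ι → Config (ball N h) → ℝ) :
    rootMean β N J h s (fun σ => ∑ i ∈ S, F i σ) = ∑ i ∈ S, rootMean β N J h s (F i) := by
  simp only [rootMean, Finset.mul_sum]
  rw [Finset.sum_comm, Finset.sum_div]

theorem rootMean_mul (c : ℝ) (F : Config (ball N h) → ℝ) :
    rootMean β N J h s (fun σ => c * F σ) = c * rootMean β N J h s F := by
  simp only [rootMean]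
  rw [← mul_div_assoc, Finset.mul_sum]
  congr 1
  exact Finset.sum_congr rfl fun σ _ => by ring

theorem rootMean_one : rootMean β N J h s (fun _ => 1) = 1 := by
  simp only [rootMean, mul_one]
  exact div_self (sum_weight_root_pos β N J h s).ne'

theorem rootMean_nonneg {F : Config (ball N h) → ℝ} (hF : ∀ σ, 0 ≤ F σ) :
    0 ≤ rootMean β N J h s F :=
  div_nonneg (Finset.sum_nonneg fun σ _ => mul_nonneg (Real.exp_pos _).le
    (mul_nonneg (by split_ifs <;> simp) (hF σ))) (sum_weight_root_pos β N J h s).le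

/-- The layer of leaves at height `h + 1` can be summed out. -/
theorem rootMean_succ (a b : List ℕ → ℝ) :
    rootMean β N J (h + 1) s (fun σ => ∏ l ∈ level N (h + 1), (a l + b l * spin σ l)) =
      rootMean β N J h s
        (fun σ => ∏ l ∈ level N (h + 1), (a l + b l * theta (β * J l) * spin σ l.tail)) := by
  have hdisj : Disjoint (ball N h) (level N (h + 1)) := Finset.disjoint_left.2 fun v h1 h2 => by
    have := ball_length N h1
    have := level_length N h2
    omega
  have htail : ∀ v ∈ ball N (h + 1), v.tail ∉ level N (h + 1) := fun v h1 h2 => by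
    have := ball_length N h1
    have := level_length N h2
    simp at this
    omega
  have hsub : ball N h ⊆ ball N (h + 1) := by
    rw [ball_succ]; exact Finset.subset_union_left
  obtain ⟨C, hC, key⟩ := exists_sum_weight_mul_prod β J (ball N h) (level N (h + 1))
    (ball N (h + 1)) (ball_succ N h) hdisj
    (fun l hl => ⟨(level_succ_tail N hl).1,
      level_subset_ball N (le_refl h) (level_succ_tail N hl).2⟩) htail hsub
  have h1 := key (fun τ => if rootSpin τ = s then 1 else 0) a b
  -- With all factors equal to 1 this is the normalisation, so the constant `C` cancels in the
  -- quotient.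
  have h2 := key (fun τ => if rootSpin τ = s then 1 else 0) (fun _ => 1) (fun _ => 0)
  simp only [zero_mul, add_zero, Finset.prod_const_one, mul_one] at h2
  have h3 := congrArg₂ (· / ·) h1 h2
  simp only [mul_div_mul_left _ _ hC.ne'] at h3
  exact h3

theorem rootMean_zero (F : Config (ball N 0) → ℝ) :
    rootMean β N J 0 s F = F (fun _ => s) := by
  have hb : ball N 0 = {[]} := by simp [ball, level]
  have hs : ∀ σ : Config (ball N 0), rootSpin σ = s → σ = fun _ => s := by
    intro σ hσ
    funext ⟨v, hv⟩
    have : v = [] := by rw [hb] at hv; simpa using hv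
    subst this
    exact hσ
  have : rootMean β N J 0 s F = rootMean β N J 0 s (fun σ => F (fun _ => s) * 1) := by
    simp only [rootMean]
    congr 1
    refine Finset.sum_congr rfl fun σ _ => ?_
    split_ifs with h
    · rw [← hs σ h]; simp
    · simp
  rw [this, rootMean_mul, rootMean_one, mul_one]

theorem levelLaw_eq_rootMean (η : Config (level N h)) :
    levelLaw β N J (le_refl h) s η =
      rootMean β N J h s (fun σ => if levelSpins (le_refl h) σ = η then 1 else 0) := by
  have hZ : 0 < ∑ τ : Config (ball N h), weight β J (ball N h) τ :=
    Finset.sum_pos (fun _ _ => Real.exp_pos _) Finset.univ_nonempty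
  simp only [levelLaw, gibbs, rootMean, ← Finset.sum_div]
  rw [div_div_div_cancel_right₀ hZ.ne', Finset.sum_filter, Finset.sum_filter]
  congr 1
  · refine Finset.sum_congr rfl fun σ _ => ?_
    by_cases h1 : rootSpin σ = s <;> by_cases h2 : levelSpins (le_refl h) σ = η <;> simp [h1, h2]
  · exact Finset.sum_congr rfl fun σ _ => by simp

theorem levelLaw_nonneg (η : Config (level N h)) : 0 ≤ levelLaw β N J (le_refl h) s η := by
  rw [levelLaw_eq_rootMean]
  exact rootMean_nonneg β N J h s fun σ => by split_ifs <;> simp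

theorem sum_levelLaw_mul (f : Config (level N h) → ℝ) :
    ∑ η, levelLaw β N J (le_refl h) s η * f η =
      rootMean β N J h s (fun σ => f (levelSpins (le_refl h) σ)) := by
  simp only [levelLaw_eq_rootMean]
  calc _ = ∑ η : Config (level N h), rootMean β N J h s
        (fun σ => f η * if levelSpins (le_refl h) σ = η then 1 else 0) :=
        Finset.sum_congr rfl fun η _ => by rw [rootMean_mul, mul_comm]
    _ = _ := by
        rw [← rootMean_sum]
        congr 1
        funext σ
        simp

theorem spin_levelSpins (σ : Config (ball N h)) {v : List ℕ} (hv : v ∈ level N h) :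
    spin (levelSpins (le_refl h) σ) v = spin σ v := by
  rw [spin_of_mem _ hv, spin_of_mem _ (level_subset_ball N (le_refl h) hv)]
  rfl

theorem prod_level_succ {M : Type*} [CommMonoid M] (f : List ℕ → M) :
    ∏ l ∈ level N (h + 1), f l = ∏ u ∈ level N h, ∏ i ∈ Finset.range (N u), f (i :: u) := by
  rw [level, Finset.prod_biUnion]
  · refine Finset.prod_congr rfl fun u _ => Finset.prod_image ?_
    intro i _ j _ hij
    simpa using hij
  · intro u _ u' _ huu
    refine Finset.disjoint_left.2 fun v h1 h2 => huu ?_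
    simp only [Finset.mem_image] at h1 h2
    obtain ⟨i, -, rfl⟩ := h1
    obtain ⟨j, -, hj⟩ := h2
    simp at hj
    exact hj.2.symm

theorem sum_level_succ {M : Type*} [AddCommMonoid M] (f : List ℕ → M) :
    ∑ l ∈ level N (h + 1), f l = ∑ u ∈ level N h, ∑ i ∈ Finset.range (N u), f (i :: u) :=
  prod_level_succ (M := Multiplicative M) N h f

theorem cons_mem_level (i : ℕ) (u : List ℕ) :
    i :: u ∈ level N (h + 1) ↔ u ∈ level N h ∧ i < N u := by
  simp only [level, Finset.mem_biUnion, Finset.mem_image, Finset.mem_range]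
  constructor
  · rintro ⟨u', hu', j, hj, hij⟩
    simp only [List.cons.injEq] at hij
    obtain ⟨rfl, rfl⟩ := hij
    exact ⟨hu', hj⟩
  · rintro ⟨h1, h2⟩
    exact ⟨u, h1, i, h2, rfl⟩

end rootMean

/-! ### Bounds on correlations, and averages over uniform spins -/

theorem theta_eq (t : ℝ) : 1 - theta t = 2 / (Real.exp t + 1) ∧
    1 + theta t = 2 * Real.exp t / (Real.exp t + 1) := by
  have : Real.exp t + 1 ≠ 0 := by positivity
  constructor <;> (rw [theta]; field_simp; ring)

theorem abs_theta_lt (t : ℝ) : |theta t| < 1 := by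
  obtain ⟨h1, h2⟩ := theta_eq t
  have h3 : 0 < 2 / (Real.exp t + 1) := by positivity
  have h4 : 0 < 2 * Real.exp t / (Real.exp t + 1) := by positivity
  exact abs_lt.2 ⟨by linarith, by linarith⟩

theorem spin_eq {V : Finset (List ℕ)} (σ : Config V) {v : List ℕ} (h : v ∈ V) :
    spin σ v = 1 ∨ spin σ v = -1 := by
  rw [spin_of_mem σ h]
  rcases Int.units_eq_one_or (σ ⟨v, h⟩) with h | h <;> simp [h]

theorem abs_spin_le {V : Finset (List ℕ)} (σ : Config V) (v : List ℕ) : |spin σ v| ≤ 1 := by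
  by_cases h : v ∈ V
  · rcases spin_eq σ h with h | h <;> simp [h]
  · simp [spin, h]

/-- The mean of a function of independent uniform spins on `V`. -/
noncomputable def signMean (V : Finset (List ℕ)) (f : (List ℕ → ℝ) → ℝ) : ℝ :=
  (∑ η : Config V, f (spin η)) / Fintype.card (Config V)

section signMean

variable {V : Finset (List ℕ)} {S T : Set (List ℕ)} {f g : (List ℕ → ℝ) → ℝ}

theorem card_config_pos (V : Finset (List ℕ)) : (0 : ℝ) < Fintype.card (Config V) := by
  exact_mod_cast Fintype.card_pos

theorem signMean_const (V : Finset (List ℕ)) (c : ℝ) : signMean V (fun _ => c) = c := by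
  have := (card_config_pos V).ne'
  rw [signMean, Finset.sum_const, Finset.card_univ, nsmul_eq_mul]
  field_simp

theorem signMean_add (V : Finset (List ℕ)) (f g : (List ℕ → ℝ) → ℝ) :
    signMean V (fun x => f x + g x) = signMean V f + signMean V g := by
  simp only [signMean, Finset.sum_add_distrib, add_div]

theorem signMean_const_mul (V : Finset (List ℕ)) (c : ℝ) (f : (List ℕ → ℝ) → ℝ) :
    signMean V (fun x => c * f x) = c * signMean V f := by
  simp only [signMean, ← Finset.mul_sum, mul_div_assoc]

theorem signMean_mono (h : ∀ x : List ℕ → ℝ, (∀ v, |x v| ≤ 1) → f x ≤ g x) :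
    signMean V f ≤ signMean V g :=
  div_le_div_of_nonneg_right (Finset.sum_le_sum fun η _ => h _ (abs_spin_le η))
    (card_config_pos V).le

/-- Functions of disjoint sets of spins are independent. -/
theorem signMean_mul (hf : DependsOn f S) (hg : DependsOn g T) (hST : Disjoint S T) :
    signMean V (fun x => f x * g x) = signMean V f * signMean V g := by
  classical
  let sw : Config V → Config V → Config V := fun η η' v => if v.1 ∈ S then η v else η' v
  have hsw1 : ∀ η η', f (spin (sw η η')) = f (spin η) := fun η η' => hf fun v hv => by
    by_cases h : v ∈ V <;> simp [spin, h, sw, hv]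
  have hsw2 : ∀ η η', g (spin (sw η' η)) = g (spin η) := fun η η' => hg fun v hv => by
    have : v ∉ S := fun h => Set.disjoint_left.1 hST h hv
    by_cases h : v ∈ V <;> simp [spin, h, sw, this]
  -- Two independent copies keep their coordinates in `S` and exchange the others. This bijection
  -- turns `f η * g η'` into `f η * g η`.
  let e : Equiv.Perm (Config V × Config V) :=
    Function.Involutive.toPerm (fun p => (sw p.1 p.2, sw p.2 p.1)) (by
      rintro ⟨η, η'⟩
      simp only [Prod.mk.injEq]
      constructor <;> funext v <;> by_cases h : v.1 ∈ S <;> simp [sw, h])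
  have h1 : (∑ η : Config V, f (spin η)) * ∑ η' : Config V, g (spin η') =
      ∑ p : Config V × Config V, f (spin p.1) * g (spin p.1) := by
    rw [Finset.sum_mul_sum, ← Fintype.sum_prod_type', ← Equiv.sum_comp e]
    refine Finset.sum_congr rfl fun p _ => ?_
    rw [← hsw1 p.1 p.2, ← hsw2 p.1 p.2, hsw1]
    show f (spin (sw p.1 p.2)) * g (spin (sw p.2 p.1)) = _
    rw [hsw1]
  have hc := (card_config_pos V).ne'
  rw [signMean, signMean, signMean, div_mul_div_comm, h1, Fintype.sum_prod_type]
  simp only [Finset.sum_const, Finset.card_univ, nsmul_eq_mul, ← Finset.mul_sum]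
  field_simp

open Classical in
/-- Changing the signs of the spins in `S`. -/
noncomputable def flip (S : Set (List ℕ)) (x : List ℕ → ℝ) (v : List ℕ) : ℝ :=
  if v ∈ S then -x v else x v

theorem signMean_flip (V : Finset (List ℕ)) (S : Set (List ℕ)) (f : (List ℕ → ℝ) → ℝ) :
    signMean V (fun x => f (flip S x)) = signMean V f := by
  classical
  let e : Equiv.Perm (Config V) :=
    Function.Involutive.toPerm (fun η v => if v.1 ∈ S then -η v else η v) (by
      intro η
      funext v
      by_cases h : v.1 ∈ S <;> simp [h])
  rw [signMean, signMean, ← Equiv.sum_comp e]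
  congr 1
  refine Finset.sum_congr rfl fun η _ => congrArg f ?_
  funext v
  by_cases hv : v ∈ V <;> by_cases h : v ∈ S <;>
    simp [flip, spin, hv, h, e, Function.Involutive.toPerm]

theorem DependsOn.flip_eq (hf : DependsOn f S) (hST : Disjoint S T) (x : List ℕ → ℝ) :
    f (flip T x) = f x := hf fun v hv => by
  have : v ∉ T := fun h => Set.disjoint_left.1 hST hv h
  simp [flip, this]

theorem DependsOn.flip_self (hf : DependsOn f S) (x : List ℕ → ℝ) : f (flip S x) = f (-x) :=
  hf fun v hv => by simp [flip, hv]

end signMean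

/-! ### Symmetric pairs of densities and their divergence -/

/-- The functions `p + q` and `p - q` of the spins in `S` are the densities, with respect to
independent uniform spins on `V`, of two probability distributions which are exchanged by a global
flip of the spins. -/
structure IsSymPair (V : Finset (List ℕ)) (S : Set (List ℕ)) (p q : (List ℕ → ℝ) → ℝ) : Prop where
  dep_left : DependsOn p S
  dep_right : DependsOn q S
  even : ∀ x, p (-x) = p x
  odd : ∀ x, q (-x) = -q x
  pos : ∀ x : List ℕ → ℝ, (∀ v, |x v| ≤ 1) → 0 < p x
  abs_le : ∀ x : List ℕ → ℝ, (∀ v, |x v| ≤ 1) → |q x| ≤ p x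
  mean : signMean V p = 1

namespace IsSymPair

variable {V : Finset (List ℕ)} {S T : Set (List ℕ)} {p q p₁ q₁ p₂ q₂ : (List ℕ → ℝ) → ℝ}

theorem mono (h : IsSymPair V S p q) (hST : S ⊆ T) : IsSymPair V T p q :=
  { h with
    dep_left := fun _ _ hx => h.dep_left fun v hv => hx v (hST hv)
    dep_right := fun _ _ hx => h.dep_right fun v hv => hx v (hST hv) }

theorem mean_right (h : IsSymPair V S p q) : signMean V q = 0 := by
  have h1 := signMean_flip V Set.univ q
  have h2 : ∀ x, q (flip Set.univ x) = -1 * q x := fun x => by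
    rw [show flip Set.univ x = -x from funext fun v => by simp [flip], h.odd]; ring
  simp only [h2, signMean_const_mul] at h1
  linarith

theorem const_mul (h : IsSymPair V S p q) {c : ℝ} (hc : |c| < 1) :
    IsSymPair V S p (fun x => c * q x) :=
  { h with
    dep_right := fun _ _ hx => by
      simp only
      rw [h.dep_right hx]
    odd := fun x => by rw [h.odd]; ring
    abs_le := fun x hx => by
      rw [abs_mul]
      exact (mul_le_of_le_one_left (abs_nonneg _) hc.le).trans (h.abs_le x hx) }

theorem abs_const_mul_lt (h : IsSymPair V S p q) {c : ℝ} (hc : |c| < 1) (x : List ℕ → ℝ)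
    (hx : ∀ v, |x v| ≤ 1) : |c * q x| < p x := by
  rw [abs_mul]
  rcases (abs_nonneg (q x)).eq_or_lt with h0 | h0
  · rw [← h0, mul_zero]; exact h.pos x hx
  · exact (mul_lt_of_lt_one_left h0 hc).trans_le (h.abs_le x hx)

theorem abs_mul_lt {a b c d : ℝ} (h1 : |b| < a) (h2 : |d| < c) :
    |a * d + b * c| < a * c + b * d := by
  obtain ⟨h3, h4⟩ := abs_lt.1 h1
  obtain ⟨h5, h6⟩ := abs_lt.1 h2
  have := mul_pos (sub_pos.2 h4) (sub_pos.2 h6)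
  have := mul_pos (neg_lt_iff_pos_add.1 h3) (neg_lt_iff_pos_add.1 h5)
  exact abs_lt.2 ⟨by nlinarith, by nlinarith⟩

/-- Two observations of one spin that are independent given it have joint densities `(p₁ ± q₁) * (p₂
± q₂)`; these are their even and odd parts. The strict bounds keep the new even part positive. -/
theorem mul (h₁ : IsSymPair V S p₁ q₁) (h₂ : IsSymPair V T p₂ q₂) (hST : Disjoint S T)
    (hlt₁ : ∀ x : List ℕ → ℝ, (∀ v, |x v| ≤ 1) → |q₁ x| < p₁ x)
    (hlt₂ : ∀ x : List ℕ → ℝ, (∀ v, |x v| ≤ 1) → |q₂ x| < p₂ x) :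
    IsSymPair V (S ∪ T) (fun x => p₁ x * p₂ x + q₁ x * q₂ x)
      (fun x => p₁ x * q₂ x + q₁ x * p₂ x) := by
  have h₁' := h₁.mono (Set.subset_union_left (t := T))
  have h₂' := h₂.mono (Set.subset_union_right (s := S))
  refine ⟨fun x y hx => ?_, fun x y hx => ?_, fun x => ?_, fun x => ?_, fun x hx => ?_,
    fun x hx => ?_, ?_⟩
  · simp only [h₁'.dep_left hx, h₁'.dep_right hx, h₂'.dep_left hx, h₂'.dep_right hx]
  · simp only [h₁'.dep_left hx, h₁'.dep_right hx, h₂'.dep_left hx, h₂'.dep_right hx]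
  · simp only [h₁.even, h₁.odd, h₂.even, h₂.odd]; ring
  · simp only [h₁.even, h₁.odd, h₂.even, h₂.odd]; ring
  · exact (abs_nonneg _).trans_lt (abs_mul_lt (hlt₁ x hx) (hlt₂ x hx))
  · exact (abs_mul_lt (hlt₁ x hx) (hlt₂ x hx)).le
  · rw [signMean_add, signMean_mul h₁.dep_left h₂.dep_left hST,
      signMean_mul h₁.dep_right h₂.dep_right hST, h₁.mean, h₂.mean, h₁.mean_right]
    norm_num

/-- The two terms on the left are q²/p for a product of two experiments, before and after flipping
the spins of the second one, which only changes the sign of `d`. Right minus left is a fraction that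
is nonnegative because `b ^ 2 ≤ a ^ 2` and `d ^ 2 ≤ c ^ 2`. -/
theorem combine_le {a b c d : ℝ} (h1 : |b| < a) (h2 : |d| < c) :
    (a * d + b * c) ^ 2 / (a * c + b * d) + (-(a * d) + b * c) ^ 2 / (a * c - b * d) ≤
      2 * (b ^ 2 / a * c + a * (d ^ 2 / c)) := by
  have ha : 0 < a := (abs_nonneg b).trans_lt h1
  have hc : 0 < c := (abs_nonneg d).trans_lt h2
  have hbd : |b * d| < a * c := by
    rw [abs_mul]
    exact mul_lt_mul'' h1 h2 (abs_nonneg _) (abs_nonneg _)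
  obtain ⟨h3, h4⟩ := abs_lt.1 hbd
  have h5 : 0 < a * c + b * d := by linarith
  have h6 : 0 < a * c - b * d := by linarith
  have hb2 : b ^ 2 ≤ a ^ 2 := sq_le_sq' (abs_lt.1 h1).1.le (abs_lt.1 h1).2.le
  have hd2 : d ^ 2 ≤ c ^ 2 := sq_le_sq' (abs_lt.1 h2).1.le (abs_lt.1 h2).2.le
  have key : 2 * (b ^ 2 / a * c + a * (d ^ 2 / c)) -
      ((a * d + b * c) ^ 2 / (a * c + b * d) + (-(a * d) + b * c) ^ 2 / (a * c - b * d)) =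
      2 * (b ^ 2 * d ^ 2) * (2 * (a ^ 2 * c ^ 2) - b ^ 2 * c ^ 2 - a ^ 2 * d ^ 2) /
        (a * c * ((a * c + b * d) * (a * c - b * d))) := by
    field_simp
    ring
  have : 0 ≤ 2 * (b ^ 2 * d ^ 2) * (2 * (a ^ 2 * c ^ 2) - b ^ 2 * c ^ 2 - a ^ 2 * d ^ 2) /
        (a * c * ((a * c + b * d) * (a * c - b * d))) := by
    refine div_nonneg (mul_nonneg (by positivity) ?_) (by positivity)
    nlinarith [mul_le_mul_of_nonneg_right hb2 (sq_nonneg c),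
      mul_le_mul_of_nonneg_left hd2 (sq_nonneg a)]
  linarith

/-- The divergence of two symmetric experiments is subadditive under products. -/
theorem signMean_div_le (h₁ : IsSymPair V S p₁ q₁) (h₂ : IsSymPair V T p₂ q₂) (hST : Disjoint S T)
    (hlt₁ : ∀ x : List ℕ → ℝ, (∀ v, |x v| ≤ 1) → |q₁ x| < p₁ x)
    (hlt₂ : ∀ x : List ℕ → ℝ, (∀ v, |x v| ≤ 1) → |q₂ x| < p₂ x) :
    signMean V (fun x => (p₁ x * q₂ x + q₁ x * p₂ x) ^ 2 / (p₁ x * p₂ x + q₁ x * q₂ x)) ≤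
      signMean V (fun x => q₁ x ^ 2 / p₁ x) + signMean V (fun x => q₂ x ^ 2 / p₂ x) := by
  -- Averaging over the flip of the spins in `T` reduces the claim to the pointwise bound
  -- `combine_le`; the stray factors `p₂` and `p₁` then have mean 1 by independence.
  have hflip := signMean_flip V T
    (fun x => (p₁ x * q₂ x + q₁ x * p₂ x) ^ 2 / (p₁ x * p₂ x + q₁ x * q₂ x))
  simp only [DependsOn.flip_eq h₁.dep_left hST, DependsOn.flip_eq h₁.dep_right hST,
    DependsOn.flip_self h₂.dep_left, DependsOn.flip_self h₂.dep_right, h₂.even, h₂.odd] at hflip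
  have h3 : signMean V (fun x => q₁ x ^ 2 / p₁ x * p₂ x) = signMean V (fun x => q₁ x ^ 2 / p₁ x) := by
    rw [signMean_mul (fun x y hx => by simp only [h₁.dep_left hx, h₁.dep_right hx]) h₂.dep_left hST,
      h₂.mean, mul_one]
  have h4 : signMean V (fun x => p₁ x * (q₂ x ^ 2 / p₂ x)) =
      signMean V (fun x => q₂ x ^ 2 / p₂ x) := by
    rw [signMean_mul (g := fun x => q₂ x ^ 2 / p₂ x) h₁.dep_left
      (fun x y hx => by simp only [h₂.dep_left hx, h₂.dep_right hx]) hST, h₁.mean, one_mul]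
  have h5 := signMean_mono (V := V) fun x hx => combine_le (hlt₁ x hx) (hlt₂ x hx)
  rw [signMean_const_mul, signMean_add, signMean_add, h3, h4] at h5
  simp only [mul_neg, ← sub_eq_add_neg] at h5 hflip
  rw [hflip] at h5
  linarith

end IsSymPair

/-! ### The law at a given distance, and the upper bound on total variation -/

/-- The even and odd parts `p` and `q` of the density of the spins `x` at distance `h` below `u`:
it is `p + q` if `u` has spin `1`, and `p - q` if `u` has spin `-1`. -/
noncomputable def density (β : ℝ) (N : List ℕ → ℕ) (J : List ℕ → ℝ) (x : List ℕ → ℝ) :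
    ℕ → List ℕ → ℝ × ℝ
  | 0, u => (1, x u)
  | h + 1, u =>
    ((∏ i ∈ Finset.range (N u), ((density β N J x h (i :: u)).1 +
          theta (β * J (i :: u)) * (density β N J x h (i :: u)).2) +
        ∏ i ∈ Finset.range (N u), ((density β N J x h (i :: u)).1 -
          theta (β * J (i :: u)) * (density β N J x h (i :: u)).2)) / 2,
      (∏ i ∈ Finset.range (N u), ((density β N J x h (i :: u)).1 +
          theta (β * J (i :: u)) * (density β N J x h (i :: u)).2) -
        ∏ i ∈ Finset.range (N u), ((density β N J x h (i :: u)).1 -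
          theta (β * J (i :: u)) * (density β N J x h (i :: u)).2)) / 2)

/-- The sum over the vertices at distance `h` below `u` of the product of the squared correlations
of the edges on the way from `u`. -/
noncomputable def pathSum (β : ℝ) (N : List ℕ → ℕ) (J : List ℕ → ℝ) : ℕ → List ℕ → ℝ
  | 0, _ => 1
  | h + 1, u => ∑ i ∈ Finset.range (N u), theta (β * J (i :: u)) ^ 2 * pathSum β N J h (i :: u)

section density

variable (β : ℝ) (N : List ℕ → ℕ) (J : List ℕ → ℝ)

/-- Summing out the lowest layer carries the densities of subtrees of depth `j` at the leaves to
those of depth `j + 1` at their parents. Since a spin is ±1, a product of such densities over the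
children is again affine in the parent spin. -/
theorem rootMean_prod_density (x : List ℕ → ℝ) (s : ℤˣ) (k j : ℕ) :
    rootMean β N J k s (fun σ => ∏ l ∈ level N k,
        ((density β N J x j l).1 + (density β N J x j l).2 * spin σ l)) =
      (density β N J x (j + k) []).1 + (density β N J x (j + k) []).2 * ((s : ℤ) : ℝ) := by
  induction k generalizing j with
  | zero =>
    rw [rootMean_zero]
    simp [level, spin_of_mem _ (nil_mem_ball N 0)]
  | succ k ih =>
    rw [rootMean_succ, show j + (k + 1) = (j + 1) + k by ring, ← ih]
    congr 1
    funext σ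
    rw [prod_level_succ]
    refine Finset.prod_congr rfl fun u hu => ?_
    rcases spin_eq σ (level_subset_ball N (le_refl k) hu) with h | h <;>
    · simp only [List.tail_cons, h, density]
      ring_nf
      exact Finset.prod_congr rfl fun i _ => by ring

theorem levelLaw_eq_density (h : ℕ) (s : ℤˣ) (η : Config (level N h)) :
    levelLaw β N J (le_refl h) s η =
      ((density β N J (spin η) h []).1 + (density β N J (spin η) h []).2 * ((s : ℤ) : ℝ)) /
        Fintype.card (Config (level N h)) := by
  have h1 := rootMean_prod_density β N J (spin η) s h 0
  rw [zero_add] at h1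
  rw [← h1, levelLaw_eq_rootMean, div_eq_inv_mul, ← rootMean_mul]
  congr 1
  funext σ
  -- The indicator of `η` is the product over the leaves of (1 + η(l)σ(l))/2, which is the case of
  -- depth 0 of the preceding product formula up to the power of 2.
  have hcard : ((Fintype.card (Config (level N h)) : ℕ) : ℝ) = ∏ _l ∈ level N h, (2 : ℝ) := by
    simp [Config]
  rw [hcard, ← Finset.prod_inv_distrib, ← Finset.prod_mul_distrib]
  split_ifs with hσ
  · symm
    refine Finset.prod_eq_one fun l hl => ?_
    simp only [density]
    rw [← spin_levelSpins N h σ hl, hσ, spin_sq η hl]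
    norm_num
  · obtain ⟨⟨l, hl⟩, hne⟩ := Function.ne_iff.1 hσ
    symm
    refine Finset.prod_eq_zero hl ?_
    simp only [density]
    rw [← spin_levelSpins N h σ hl, spin_of_mem _ hl, spin_of_mem _ hl]
    rcases Int.units_eq_one_or (levelSpins (le_refl h) σ ⟨l, hl⟩) with h1 | h1 <;>
      rcases Int.units_eq_one_or (η ⟨l, hl⟩) with h2 | h2 <;> simp [h1, h2] at hne ⊢

theorem tvDist_eq_signMean (h : ℕ) :
    tvDist β N J h = signMean (level N h) (fun x => |(density β N J x h []).2|) := by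
  have hc := card_config_pos (level N h)
  rw [tvDist, signMean, Finset.mul_sum, Finset.sum_div]
  refine Finset.sum_congr rfl fun η _ => ?_
  rw [levelLaw_eq_density, levelLaw_eq_density, ← sub_div, abs_div, abs_of_pos hc]
  simp only [Units.val_one, Units.val_neg, Int.cast_one, Int.cast_neg, mul_one, mul_neg]
  rw [show ∀ p q : ℝ, p + q - (p + -q) = 2 * q by intros; ring, abs_mul, abs_two]
  ring

theorem suffix_cons_inj {i j : ℕ} {u v : List ℕ} (h₁ : i :: u <:+ v) (h₂ : j :: u <:+ v) :
    i = j := by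
  have := List.suffix_of_suffix_length_le h₁ h₂ (by simp)
  have := this.eq_of_length (by simp)
  simpa using this

/-- Induction on the number of independent observations, adding one factor at a time; the
divergences add up at most. -/
theorem isSymPair_prod {V : Finset (List ℕ)} {B : ℕ → Set (List ℕ)} {p q : ℕ → (List ℕ → ℝ) → ℝ}
    (hpq : ∀ i, IsSymPair V (B i) (p i) (q i))
    (hlt : ∀ i, ∀ x : List ℕ → ℝ, (∀ v, |x v| ≤ 1) → |q i x| < p i x)
    (hB : ∀ i j, i ≠ j → Disjoint (B i) (B j)) (n : ℕ) :
    IsSymPair V (⋃ i < n, B i)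
        (fun x => (∏ i ∈ Finset.range n, (p i x + q i x) +
          ∏ i ∈ Finset.range n, (p i x - q i x)) / 2)
        (fun x => (∏ i ∈ Finset.range n, (p i x + q i x) -
          ∏ i ∈ Finset.range n, (p i x - q i x)) / 2) ∧
      signMean V (fun x => ((∏ i ∈ Finset.range n, (p i x + q i x) -
          ∏ i ∈ Finset.range n, (p i x - q i x)) / 2) ^ 2 /
          ((∏ i ∈ Finset.range n, (p i x + q i x) +
          ∏ i ∈ Finset.range n, (p i x - q i x)) / 2)) ≤
        ∑ i ∈ Finset.range n, signMean V (fun x => q i x ^ 2 / p i x) := by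
  have hlt' : ∀ n, ∀ x : List ℕ → ℝ, (∀ v, |x v| ≤ 1) →
      |(∏ i ∈ Finset.range n, (p i x + q i x) - ∏ i ∈ Finset.range n, (p i x - q i x)) / 2| <
        (∏ i ∈ Finset.range n, (p i x + q i x) + ∏ i ∈ Finset.range n, (p i x - q i x)) / 2 := by
    intro n x hx
    have h1 : 0 < ∏ i ∈ Finset.range n, (p i x + q i x) :=
      Finset.prod_pos fun i _ => by linarith [(abs_lt.1 (hlt i x hx)).1]
    have h2 : 0 < ∏ i ∈ Finset.range n, (p i x - q i x) :=
      Finset.prod_pos fun i _ => by linarith [(abs_lt.1 (hlt i x hx)).2]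
    exact abs_lt.2 ⟨by linarith, by linarith⟩
  induction n with
  | zero =>
    simp only [Finset.range_zero, Finset.prod_empty, Finset.sum_empty]
    norm_num
    refine ⟨⟨fun _ _ _ => rfl, fun _ _ _ => rfl, ?_, ?_, ?_, ?_, ?_⟩, ?_⟩ <;>
      simp [signMean_const]
  | succ n ih =>
    have hdisj : Disjoint (⋃ i < n, B i) (B n) := by
      simp only [Set.disjoint_iUnion_left]
      exact fun i hi => hB i n hi.ne
    have h1 := ih.1.mul (hpq n) hdisj (hlt' n) (hlt n)
    have h2 := ih.1.signMean_div_le (hpq n) hdisj (hlt' n) (hlt n)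
    have hS : (⋃ i < n, B i) ∪ B n = ⋃ i < n + 1, B i := by
      rw [Set.biUnion_lt_succ]
    simp only [Finset.prod_range_succ, Finset.sum_range_succ]
    constructor
    · rw [← hS]
      convert h1 using 2 <;> ring
    · refine le_trans (le_of_eq ?_) (h2.trans (add_le_add ih.2 le_rfl))
      congr 1
      funext x
      congr 1 <;> ring

/-- The subtrees of distinct children involve disjoint sets of spins, so their divergences add up at
most, after a factor `theta ^ 2` on each edge. That factor also makes `|q| < p` strict before
multiplying: at a leaf `|q| = p` can occur. -/
theorem isSymPair_density (V : Finset (List ℕ)) (h : ℕ) (u : List ℕ) :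
    IsSymPair V {v | u <:+ v} (fun x => (density β N J x h u).1)
        (fun x => (density β N J x h u).2) ∧
      signMean V (fun x => (density β N J x h u).2 ^ 2 / (density β N J x h u).1) ≤
        pathSum β N J h u := by
  induction h generalizing u with
  | zero =>
    simp only [density, pathSum, div_one]
    refine ⟨⟨fun _ _ _ => rfl, fun x y hx => hx u (List.suffix_refl u), fun _ => rfl,
      fun _ => rfl, fun _ _ => one_pos, fun x hx => hx u, signMean_const V 1⟩, ?_⟩
    rw [← signMean_const V 1]
    exact signMean_mono fun x hx => (sq_le_one_iff_abs_le_one _).2 (hx u)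
  | succ h ih =>
    have hB : ∀ i j : ℕ, i ≠ j →
        Disjoint {v : List ℕ | i :: u <:+ v} {v : List ℕ | j :: u <:+ v} :=
      fun i j hij => Set.disjoint_left.2 fun v h1 h2 => hij (suffix_cons_inj h1 h2)
    have key := isSymPair_prod
      (fun i => (ih (i :: u)).1.const_mul (abs_theta_lt (β * J (i :: u))))
      (fun i => (ih (i :: u)).1.abs_const_mul_lt (abs_theta_lt (β * J (i :: u)))) hB (N u)
    refine ⟨key.1.mono ?_, key.2.trans ?_⟩
    · simp only [Set.iUnion_subset_iff]
      exact fun i _ v hv => (List.suffix_cons i u).trans hv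
    · refine Finset.sum_le_sum fun i _ => ?_
      simp only [mul_pow, mul_div_assoc, signMean_const_mul]
      exact mul_le_mul_of_nonneg_left (ih (i :: u)).2 (sq_nonneg _)

/-- By the arithmetic-geometric mean inequality, |q| ≤ (εp + ε⁻¹q²/p)/2. Keeping `ε` free replaces
Cauchy–Schwarz by a bound linear in the divergence. -/
theorem tvDist_le (h : ℕ) {ε : ℝ} (hε : 0 < ε) :
    tvDist β N J h ≤ (ε + ε⁻¹ * pathSum β N J h []) / 2 := by
  obtain ⟨h1, h2⟩ := isSymPair_density β N J (level N h) h []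
  have h3 : tvDist β N J h ≤ signMean (level N h) (fun x => ε / 2 * (density β N J x h []).1 +
      ε⁻¹ / 2 * ((density β N J x h []).2 ^ 2 / (density β N J x h []).1)) := by
    rw [tvDist_eq_signMean]
    refine signMean_mono fun x hx => ?_
    have hp : 0 < (density β N J x h []).1 := h1.pos x hx
    set p := (density β N J x h []).1
    set q := (density β N J x h []).2
    have : ε / 2 * p + ε⁻¹ / 2 * (q ^ 2 / p) - |q| = (ε * p - |q|) ^ 2 / (2 * ε * p) := by
      rw [← sq_abs q]
      field_simp
      ring
    have h0 : 0 ≤ (ε * p - |q|) ^ 2 / (2 * ε * p) := by positivity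
    linarith
  rw [signMean_add, signMean_const_mul, signMean_const_mul, h1.mean] at h3
  have := mul_le_mul_of_nonneg_left h2 (by positivity : 0 ≤ ε⁻¹ / 2)
  linarith

/-- Reconciles the recursion of `pathSum`, which starts at the upper end of a path, with weights
defined from its lower end: each step of the induction moves one level of edges from one to the
other. -/
theorem sum_level_path (h k : ℕ) (w : List ℕ → ℝ)
    (hw : ∀ i u, w (i :: u) = theta (β * J (i :: u)) ^ 2 * w u) :
    ∑ v ∈ level N k, w v * pathSum β N J h v = w [] * pathSum β N J (h + k) [] := by
  induction k generalizing h with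
  | zero => simp [level]
  | succ k ih =>
    rw [show h + (k + 1) = (h + 1) + k by ring, ← ih, sum_level_succ]
    refine Finset.sum_congr rfl fun u _ => ?_
    simp only [pathSum, Finset.mul_sum, hw]
    exact Finset.sum_congr rfl fun i _ => by ring

end density

/-! ### The weighted-sum estimator of the root spin -/

/-- The correlation of the spins of `v` and the root: the product of the correlations of the edges
between them. -/
noncomputable def pathWeight (β : ℝ) (J : List ℕ → ℝ) : List ℕ → ℝ
  | [] => 1
  | i :: u => theta (β * J (i :: u)) * pathWeight β J u

/-- The correlation of the spins of two vertices at the same distance from the root. -/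
noncomputable def pairCorr (β : ℝ) (J : List ℕ → ℝ) : List ℕ → List ℕ → ℝ
  | i :: u, j :: u' => if i :: u = j :: u' then 1 else
      theta (β * J (i :: u)) * theta (β * J (j :: u')) * pairCorr β J u u'
  | _, _ => 1

/-- The vertices other than the root on the paths from the root to two vertices at the same
distance from it. -/
def pairPath : List ℕ → List ℕ → Finset (List ℕ)
  | i :: u, j :: u' => insert (i :: u) (insert (j :: u') (pairPath u u'))
  | _, _ => ∅

theorem length_le_of_mem_pairPath {u u' x : List ℕ} (h : u.length = u'.length)
    (hx : x ∈ pairPath u u') : x.length ≤ u.length := by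
  induction u generalizing u' with
  | nil => simp [pairPath] at hx
  | cons i u ih =>
    cases u' with
    | nil => simp [pairPath] at hx
    | cons j u' =>
      simp only [List.length_cons, add_left_inj] at h
      simp only [pairPath, Finset.mem_insert] at hx
      rcases hx with rfl | rfl | hx
      · simp
      · simp [h]
      · have := ih h hx
        simp; omega

theorem cons_notMem_pairPath {u u' v : List ℕ} (h : u.length = u'.length) (i : ℕ)
    (hv : v.length = u.length) : i :: v ∉ pairPath u u' := fun hx => by
  have := length_le_of_mem_pairPath h hx
  simp at this
  omega

theorem prod_pairPath_cons {M : Type*} [CommMonoid M] {i j : ℕ} {u u' : List ℕ}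
    (h : u.length = u'.length) (hne : i :: u ≠ j :: u') (f : List ℕ → M) :
    ∏ x ∈ pairPath (i :: u) (j :: u'), f x =
      f (i :: u) * (f (j :: u') * ∏ x ∈ pairPath u u', f x) := by
  rw [pairPath, Finset.prod_insert, Finset.prod_insert]
  · exact cons_notMem_pairPath h j h.symm
  · simp only [Finset.mem_insert, not_or]
    exact ⟨hne, cons_notMem_pairPath h i rfl⟩

theorem prod_pairPath_cons_self {M : Type*} [CommMonoid M] (i : ℕ) (u : List ℕ) (f : List ℕ → M) :
    ∏ x ∈ pairPath (i :: u) (i :: u), f x = f (i :: u) * ∏ x ∈ pairPath u u, f x := by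
  rw [pairPath, Finset.insert_idem, Finset.prod_insert]
  exact cons_notMem_pairPath rfl i rfl

section

variable (β : ℝ) (N : List ℕ → ℕ) (J : List ℕ → ℝ)

theorem prod_pairPath_self (v : List ℕ) :
    ∏ x ∈ pairPath v v, theta (β * J x) ^ 2 = pathWeight β J v ^ 2 := by
  induction v with
  | nil => simp [pairPath, pathWeight]
  | cons i u ih => rw [prod_pairPath_cons_self, ih, pathWeight, mul_pow]

/-- An edge common to both paths occurs once in each path weight; any other edge occurs once in a
path weight and once in the pair correlation. Every edge of the union is thus squared. -/
theorem pathWeight_mul_pairCorr {v v' : List ℕ} (h : v.length = v'.length) :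
    pathWeight β J v * pathWeight β J v' * pairCorr β J v v' =
      ∏ x ∈ pairPath v v', theta (β * J x) ^ 2 := by
  induction v generalizing v' with
  | nil =>
    obtain rfl : v' = [] := List.length_eq_zero_iff.1 h.symm
    simp [pathWeight, pairCorr, pairPath]
  | cons i u ih =>
    cases v' with
    | nil => simp at h
    | cons j u' =>
      simp only [List.length_cons, add_left_inj] at h
      by_cases hne : i :: u = j :: u'
      · rw [← hne, prod_pairPath_self, pairCorr, if_pos rfl]
        ring
      · rw [prod_pairPath_cons h hne, ← ih h, pairCorr, if_neg hne, pathWeight, pathWeight]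
        ring

theorem rootMean_spin (h : ℕ) (s : ℤˣ) {v : List ℕ} (hv : v ∈ level N h) :
    rootMean β N J h s (fun σ => spin σ v) = ((s : ℤ) : ℝ) * pathWeight β J v := by
  induction h generalizing v with
  | zero =>
    obtain rfl : v = [] := by simpa [level] using hv
    rw [rootMean_zero]
    simp [spin_of_mem _ (nil_mem_ball N 0), pathWeight]
  | succ h ih =>
    cases v with
    | nil => exact absurd rfl (level_succ_tail N hv).1
    | cons i u =>
      -- These coefficients make the product over the leaves collapse to the spin of `i :: u`.
      have h1 := rootMean_succ β N J h s (fun l => if l = i :: u then 0 else 1)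
        (fun l => if l = i :: u then 1 else 0)
      have h2 : ∀ f : List ℕ → ℝ, ∏ l ∈ level N (h + 1), ((if l = i :: u then 0 else 1) +
          (if l = i :: u then 1 else 0) * f l) = f (i :: u) := by
        intro f
        rw [Finset.prod_eq_single_of_mem _ hv (fun l _ hl => by simp [hl])]
        simp
      simp only [h2, mul_assoc] at h1
      rw [h1]
      simp only [List.tail_cons]
      rw [rootMean_mul, ih ((cons_mem_level N h i u).1 hv).1, pathWeight]
      ring

theorem rootMean_spin_mul (h : ℕ) (s : ℤˣ) {v v' : List ℕ} (hv : v ∈ level N h)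
    (hv' : v' ∈ level N h) :
    rootMean β N J h s (fun σ => spin σ v * spin σ v') = pairCorr β J v v' := by
  induction h generalizing v v' with
  | zero =>
    obtain rfl : v = [] := by simpa [level] using hv
    obtain rfl : v' = [] := by simpa [level] using hv'
    rw [rootMean_zero, spin_sq _ (nil_mem_ball N 0), pairCorr]
    simp
  | succ h ih =>
    cases v with
    | nil => exact absurd rfl (level_succ_tail N hv).1
    | cons i u =>
    cases v' with
    | nil => exact absurd rfl (level_succ_tail N hv').1
    | cons j u' =>
      rw [pairCorr]
      split_ifs with hne
      · simp only [← hne, spin_sq _ (level_subset_ball N le_rfl hv), rootMean_one]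
      have h1 := rootMean_succ β N J h s
        (fun l => if l = i :: u then 0 else if l = j :: u' then 0 else 1)
        (fun l => if l = i :: u then 1 else if l = j :: u' then 1 else 0)
      have h2 : ∀ f : List ℕ → ℝ, ∏ l ∈ level N (h + 1),
          ((if l = i :: u then 0 else if l = j :: u' then 0 else 1) +
          (if l = i :: u then 1 else if l = j :: u' then 1 else 0) * f l) =
            f (i :: u) * f (j :: u') := by
        intro f
        rw [Finset.prod_eq_mul_of_mem _ _ hv hv' hne (fun l _ hl => by simp [hl.1, hl.2])]
        simp [Ne.symm hne]
      simp only [h2, mul_assoc] at h1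
      rw [h1]
      simp only [List.tail_cons]
      rw [← ih ((cons_mem_level N h i u).1 hv).1 ((cons_mem_level N h j u').1 hv').1,
        ← rootMean_mul]
      congr 1
      funext σ
      ring

/-- A lower bound for the total variation distance by the second moment method. -/
theorem le_tvDist (h : ℕ) (t : ℝ) :
    2 * t * ∑ v ∈ level N h, ∏ x ∈ pairPath v v, theta (β * J x) ^ 2 ≤
      tvDist β N J h + t ^ 2 * ∑ v ∈ level N h, ∑ v' ∈ level N h,
        ∏ x ∈ pairPath v v', theta (β * J x) ^ 2 := by
  let f : Config (level N h) → ℝ := fun η => ∑ v ∈ level N h, pathWeight β J v * spin η v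
  have hfirst : ∀ s : ℤˣ, ∑ η, levelLaw β N J (le_refl h) s η * f η =
      ((s : ℤ) : ℝ) * ∑ v ∈ level N h, ∏ x ∈ pairPath v v, theta (β * J x) ^ 2 := by
    intro s
    rw [sum_levelLaw_mul, rootMean_sum, Finset.mul_sum]
    refine Finset.sum_congr rfl fun v hv => ?_
    simp only [spin_levelSpins N h _ hv]
    rw [rootMean_mul, rootMean_spin β N J h s hv, prod_pairPath_self]
    ring
  have hsecond : ∀ s : ℤˣ, ∑ η, levelLaw β N J (le_refl h) s η * f η ^ 2 =
      ∑ v ∈ level N h, ∑ v' ∈ level N h, ∏ x ∈ pairPath v v', theta (β * J x) ^ 2 := by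
    intro s
    simp only [f, sq, Finset.sum_mul_sum]
    rw [sum_levelLaw_mul, rootMean_sum]
    refine Finset.sum_congr rfl fun v hv => ?_
    rw [rootMean_sum]
    refine Finset.sum_congr rfl fun v' hv' => ?_
    simp only [spin_levelSpins N h _ hv, spin_levelSpins N h _ hv', mul_mul_mul_comm]
    rw [rootMean_mul, rootMean_spin_mul β N J h s hv hv', pathWeight_mul_pairCorr β J
      ((level_length N hv).trans (level_length N hv').symm)]
    exact Finset.prod_congr rfl fun x _ => sq _
  have h1 := hfirst 1
  have h2 := hfirst (-1)
  have h3 := hsecond 1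
  have h4 := hsecond (-1)
  simp only [Units.val_one, Units.val_neg, Int.cast_one, Int.cast_neg, one_mul, neg_mul] at h1 h2
  set Z := ∑ v ∈ level N h, ∏ x ∈ pairPath v v, theta (β * J x) ^ 2
  set W := ∑ v ∈ level N h, ∑ v' ∈ level N h, ∏ x ∈ pairPath v v', theta (β * J x) ^ 2
  -- Pointwise, t(p - q)f ≤ |p - q|(1 + t²f²)/2, and |p - q| ≤ p + q in the second term.
  have key : ∑ η, t * ((levelLaw β N J (le_refl h) 1 η * f η) -
        levelLaw β N J (le_refl h) (-1) η * f η) ≤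
      ∑ η, (1 / 2 * |levelLaw β N J (le_refl h) 1 η - levelLaw β N J (le_refl h) (-1) η| +
        t ^ 2 / 2 * (levelLaw β N J (le_refl h) 1 η * f η ^ 2 +
          levelLaw β N J (le_refl h) (-1) η * f η ^ 2)) := by
    refine Finset.sum_le_sum fun η _ => ?_
    have hp := levelLaw_nonneg β N J h 1 η
    have hq := levelLaw_nonneg β N J h (-1) η
    set p := levelLaw β N J (le_refl h) 1 η
    set q := levelLaw β N J (le_refl h) (-1) η
    have hpq : |p - q| ≤ p + q := abs_le.2 ⟨by linarith, by linarith⟩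
    have a1 := mul_le_mul_of_nonneg_right hpq (sq_nonneg (t * f η))
    have a2 : (p - q) * (t * f η) ≤ |p - q| * |t * f η| := by
      rw [← abs_mul]; exact le_abs_self _
    have a3 := mul_nonneg (abs_nonneg (p - q)) (sq_nonneg (|t * f η| - 1))
    rw [sub_sq, sq_abs] at a3
    nlinarith
  rw [Finset.sum_add_distrib, ← Finset.mul_sum, ← Finset.mul_sum, ← Finset.mul_sum,
    Finset.sum_sub_distrib, Finset.sum_add_distrib, h1, h2, h3, h4] at key
  rw [tvDist]
  linarith

theorem pathSum_nil (h : ℕ) :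
    pathSum β N J h [] = ∑ v ∈ level N h, ∏ x ∈ pairPath v v, theta (β * J x) ^ 2 := by
  have := sum_level_path β N J 0 h (fun v => pathWeight β J v ^ 2)
    (fun i u => by rw [pathWeight, mul_pow])
  simpa [pathSum, pathWeight, prod_pairPath_self, eq_comm] using this

end

/-! ### Independence under product measures -/

theorem measurable_theta : Measurable theta := by
  unfold theta
  fun_prop

/-- Functions of disjoint finite sets of coordinates are independent. -/
theorem lintegral_infinitePi_mul_eval {X : Type*} [MeasurableSpace X] (μ : Measure X)
    [IsProbabilityMeasure μ] {ι : Type*} {S : Finset ι} {u : ι} (hu : u ∉ S)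
    {F : (ι → X) → ENNReal} (hF : Measurable F) (hS : DependsOn F (S : Set ι)) {g : X → ENNReal}
    (hg : Measurable g) :
    ∫⁻ N, F N * g (N u) ∂(Measure.infinitePi fun _ : ι => μ) =
      (∫⁻ N, F N ∂(Measure.infinitePi fun _ : ι => μ)) * ∫⁻ x, g x ∂μ := by
  classical
  obtain ⟨x₀⟩ : Nonempty X := by
    by_contra h
    rw [not_nonempty_iff] at h
    have := measure_univ (μ := μ)
    simp [Set.eq_empty_of_isEmpty] at this
  -- Extending by a fixed value exhibits `F` as a function of the restriction to `S`.
  let E : (S → X) → ι → X := fun y i => if h : i ∈ S then y ⟨i, h⟩ else x₀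
  have hE : Measurable E := measurable_pi_iff.2 fun i => by
    by_cases h : i ∈ S
    · simpa [E, h] using measurable_pi_apply _
    · simp [E, h]
  have hFE : ∀ N, F N = F (E fun i => N i) := fun N => hS fun i hi => by
    have : i ∈ S := hi
    simp [E, this]
  have hind := (iIndepFun_infinitePi (P := fun _ : ι => μ) (X := fun _ x => x)
    fun _ => measurable_id).indepFun_finset S {u} (Finset.disjoint_singleton_right.2 hu)
    fun i => measurable_pi_apply i
  have hind2 := hind.comp (φ := fun y => F (E y))
    (ψ := fun y : ({u} : Finset ι) → X => g (y ⟨u, Finset.mem_singleton_self u⟩))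
    (hF.comp hE) (hg.comp (measurable_pi_apply _))
  have key := lintegral_mul_eq_lintegral_mul_lintegral_of_indepFun'' (μ := Measure.infinitePi fun _ : ι => μ)
    (f := F) (g := fun N => g (N u)) hF.aemeasurable
    (hg.comp (measurable_pi_apply u)).aemeasurable (by
      have e : F = (fun y => F (E y)) ∘ fun N (i : S) => N i := funext hFE
      rw [e]
      exact hind2)
  rw [key]
  congr 1
  exact (measurePreserving_eval_infinitePi (fun _ : ι => μ) u).lintegral_comp hg

theorem lintegral_infinitePi_prod {X : Type*} [MeasurableSpace X] (μ : Measure X)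
    [IsProbabilityMeasure μ] {ι : Type*} (S : Finset ι) {g : X → ENNReal} (hg : Measurable g) :
    ∫⁻ N, ∏ i ∈ S, g (N i) ∂(Measure.infinitePi fun _ : ι => μ) = (∫⁻ x, g x ∂μ) ^ S.card := by
  have := lintegral_prod_eq_prod_lintegral_of_indepFun (μ := Measure.infinitePi fun _ : ι => μ) S
    (fun i N => g (N i)) (iIndepFun_infinitePi (P := fun _ : ι => μ) (X := fun _ x => g x)
    fun _ => hg) (fun i => hg.comp (measurable_pi_apply i))
  rw [this]
  have h2 : ∀ i : ι, ∫⁻ N, g (N i) ∂(Measure.infinitePi fun _ : ι => μ) = ∫⁻ x, g x ∂μ :=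
    fun i => (measurePreserving_eval_infinitePi (fun _ : ι => μ) i).lintegral_comp hg
  simp [h2]

/-- The second moment of the correlation of an edge. -/
noncomputable def edgeMoment (β : ℝ) : ENNReal :=
  ∫⁻ y, ENNReal.ofReal (theta (β * y) ^ 2) ∂(gaussianReal 0 1)

theorem lintegral_prod_theta (β : ℝ) (A : Finset (List ℕ)) :
    ∫⁻ J : List ℕ → ℝ, ENNReal.ofReal (∏ x ∈ A, theta (β * J x) ^ 2)
      ∂(Measure.infinitePi fun _ : List ℕ => gaussianReal 0 1) = edgeMoment β ^ A.card := by
  simp only [ENNReal.ofReal_prod_of_nonneg fun _ _ => sq_nonneg _]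
  refine lintegral_infinitePi_prod _ A
    (g := fun y => ENNReal.ofReal (theta (β * y) ^ 2)) ?_
  exact ((measurable_theta.comp (measurable_const_mul β)).pow_const 2).ennreal_ofReal

theorem measurable_prod_theta (β : ℝ) (A : Finset (List ℕ)) :
    Measurable fun J : List ℕ → ℝ => ENNReal.ofReal (∏ x ∈ A, theta (β * J x) ^ 2) := by
  refine (Finset.measurable_prod A fun x _ => ?_).ennreal_ofReal
  exact (measurable_theta.comp ((measurable_const_mul β).comp (measurable_pi_apply x))).pow_const 2

/-! ### Events and sums on the random tree -/

/-- The suffixes of a word other than the word itself. -/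
def properSuffixes : List ℕ → Finset (List ℕ)
  | [] => ∅
  | _ :: u => insert u (properSuffixes u)

theorem length_lt_of_mem_properSuffixes {u x : List ℕ} (hx : x ∈ properSuffixes u) :
    x.length < u.length := by
  induction u with
  | nil => simp [properSuffixes] at hx
  | cons i u ih =>
    simp only [properSuffixes, Finset.mem_insert] at hx
    rcases hx with rfl | hx
    · simp
    · have := ih hx
      simp; omega

/-- Whether a word belongs to the tree is decided by the offspring numbers of its proper ancestors,
hence is independent of its own offspring number. -/
theorem dependsOn_mem_level (h : ℕ) (u : List ℕ) :
    DependsOn (fun N : List ℕ → ℕ => u ∈ level N h) (properSuffixes u : Set (List ℕ)) := by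
  induction h generalizing u with
  | zero => exact fun _ _ _ => by simp [level]
  | succ h ih =>
    intro N N' hN
    cases u with
    | nil => simp [level]
    | cons i u =>
      simp only [cons_mem_level, properSuffixes, Finset.coe_insert, Set.mem_insert_iff] at hN ⊢
      rw [hN u (Or.inl rfl)]
      have : (u ∈ level N h) = (u ∈ level N' h) := ih u fun v hv => hN v (Or.inr hv)
      rw [this]

theorem measurableSet_mem_level (h : ℕ) (u : List ℕ) :
    MeasurableSet {N : List ℕ → ℕ | u ∈ level N h} := by
  induction h generalizing u with
  | zero => simp [level]
  | succ h ih =>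
    cases u with
    | nil => simp [level]
    | cons i u =>
      simp only [cons_mem_level]
      exact (ih u).inter (measurableSet_lt measurable_const (measurable_pi_apply u))

/-- Turns a sum over a random set into one over a fixed countable set, which gives measurability and
termwise integration. -/
theorem sum_level_eq_tsum (N : List ℕ → ℕ) (h : ℕ) (f : List ℕ → ENNReal) :
    ∑ u ∈ level N h, f u = ∑' u, if u ∈ level N h then f u else 0 := by
  rw [tsum_eq_sum (s := level N h) fun u hu => if_neg hu]
  exact Finset.sum_congr rfl fun u hu => (if_pos hu).symm

theorem measurable_ite_level (h : ℕ) (u : List ℕ) {F : (List ℕ → ℕ) → ENNReal}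
    (hF : Measurable F) : Measurable fun N => if u ∈ level N h then F N else 0 :=
  Measurable.ite (measurableSet_mem_level h u) hF measurable_const

theorem measurable_sum_level (h : ℕ) {F : (List ℕ → ℕ) → List ℕ → ENNReal}
    (hF : ∀ u, Measurable fun N => F N u) : Measurable fun N => ∑ u ∈ level N h, F N u := by
  simp only [sum_level_eq_tsum]
  exact Measurable.tsum fun u => measurable_ite_level h u (hF u)

theorem lintegral_sum_level (μ : Measure (List ℕ → ℕ)) (h : ℕ)
    {F : (List ℕ → ℕ) → List ℕ → ENNReal} (hF : ∀ u, Measurable fun N => F N u) :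
    ∫⁻ N, ∑ u ∈ level N h, F N u ∂μ = ∑' u, ∫⁻ N, (if u ∈ level N h then F N u else 0) ∂μ := by
  simp only [sum_level_eq_tsum]
  exact lintegral_tsum fun u => (measurable_ite_level h u (hF u)).aemeasurable

theorem lintegral_sum_sum_level (μ : Measure (List ℕ → ℕ)) (h : ℕ)
    {F : (List ℕ → ℕ) → List ℕ → List ℕ → ENNReal} (hF : ∀ u u', Measurable fun N => F N u u') :
    ∫⁻ N, ∑ u ∈ level N h, ∑ u' ∈ level N h, F N u u' ∂μ = ∑' u, ∑' u',
      ∫⁻ N, (if u ∈ level N h then if u' ∈ level N h then F N u u' else 0 else 0) ∂μ := by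
  rw [lintegral_sum_level μ h fun u => measurable_sum_level h (hF u)]
  refine tsum_congr fun u => ?_
  rw [← lintegral_tsum fun u' =>
    (measurable_ite_level h u (measurable_ite_level h u' (hF u u'))).aemeasurable]
  refine lintegral_congr fun N => ?_
  split_ifs
  · exact sum_level_eq_tsum N h _
  · simp

/-! ### Moment recursions over generations -/

section moments

variable (ζ : PMF ℕ)

/-- The law of the numbers of children. -/
noncomputable def treeLaw : Measure (List ℕ → ℕ) :=
  Measure.infinitePi fun _ : List ℕ => ζ.toMeasure

theorem notMem_properSuffixes {u v : List ℕ} (h : u.length ≤ v.length) : v ∉ properSuffixes u :=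
  fun hv => (length_lt_of_mem_properSuffixes hv).not_ge h

theorem lintegral_ite_level_mul (h : ℕ) (u : List ℕ) (κ : ENNReal) (g : ℕ → ENNReal) :
    ∫⁻ N, (if u ∈ level N h then κ * g (N u) else 0) ∂treeLaw ζ =
      ∫⁻ N, (if u ∈ level N h then κ * ∫⁻ k, g k ∂ζ.toMeasure else 0) ∂treeLaw ζ := by
  have h1 : Measurable fun N : List ℕ → ℕ => if u ∈ level N h then κ else 0 :=
    measurable_ite_level h u measurable_const
  have h2 := lintegral_infinitePi_mul_eval ζ.toMeasure (notMem_properSuffixes (le_refl u.length))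
    h1 (fun N N' hN => by
      have : (u ∈ level N h) = (u ∈ level N' h) := dependsOn_mem_level h u hN
      simp only [this])
    (measurable_from_top (f := g))
  simp only [ite_mul, zero_mul] at h2
  rw [treeLaw, h2, ← lintegral_mul_const _ h1]
  simp only [ite_mul, zero_mul]

/-- Distinct words of equal length are not ancestors of one another, so both offspring numbers are
independent of the two membership events and of each other. -/
theorem lintegral_ite_level_mul_mul (h : ℕ) {u u' : List ℕ} (hlen : u.length = u'.length)
    (hne : u ≠ u') (κ : ENNReal) (g : ℕ → ENNReal) :
    ∫⁻ N, (if u ∈ level N h then if u' ∈ level N h then κ * g (N u) * g (N u') else 0 else 0)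
        ∂treeLaw ζ =
      ∫⁻ N, (if u ∈ level N h then if u' ∈ level N h then
        κ * (∫⁻ k, g k ∂ζ.toMeasure) * ∫⁻ k, g k ∂ζ.toMeasure else 0 else 0) ∂treeLaw ζ := by
  have hg : Measurable g := measurable_from_top
  have h1 : Measurable fun N : List ℕ → ℕ =>
      if u ∈ level N h then if u' ∈ level N h then κ else 0 else 0 :=
    measurable_ite_level h u (measurable_ite_level h u' measurable_const)
  have hdep : DependsOn (fun N : List ℕ → ℕ =>
      if u ∈ level N h then if u' ∈ level N h then κ else 0 else 0)
      ((properSuffixes u ∪ properSuffixes u' : Finset (List ℕ)) : Set (List ℕ)) := by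
    intro N N' hN
    have e1 : (u ∈ level N h) = (u ∈ level N' h) :=
      dependsOn_mem_level h u fun v hv => hN v (by simp at hv ⊢; exact Or.inl hv)
    have e2 : (u' ∈ level N h) = (u' ∈ level N' h) :=
      dependsOn_mem_level h u' fun v hv => hN v (by simp at hv ⊢; exact Or.inr hv)
    simp only [e1, e2]
  have h2 := lintegral_infinitePi_mul_eval ζ.toMeasure (u := u)
    (by simp [notMem_properSuffixes (le_refl u.length), notMem_properSuffixes hlen.ge]) h1 hdep hg
  have h3 := lintegral_infinitePi_mul_eval ζ.toMeasure
    (S := insert u (properSuffixes u ∪ properSuffixes u')) (u := u')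
    (by simp [notMem_properSuffixes (le_refl u'.length), notMem_properSuffixes hlen.le, hne.symm])
    (h1.mul (hg.comp (measurable_pi_apply u)))
    (fun N N' hN => by
      simp only [Finset.coe_insert, Set.mem_insert_iff] at hN
      simp only [Pi.mul_apply, Function.comp_apply, hN u (Or.inl rfl)]
      congr 1
      exact hdep fun v hv => hN v (Or.inr hv)) hg
  simp only [Pi.mul_apply, Function.comp_apply] at h3
  rw [h2, ← lintegral_mul_const _ h1, ← lintegral_mul_const _ (h1.mul_const _)] at h3
  simp only [ite_mul, zero_mul] at h3
  exact h3

theorem card_pairPath_cons (i j : ℕ) {u u' : List ℕ} (h : u.length = u'.length) :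
    (pairPath (i :: u) (j :: u')).card =
      (pairPath u u').card + if i :: u = j :: u' then 1 else 2 := by
  split_ifs with hne
  · simp only [List.cons.injEq] at hne
    obtain ⟨rfl, rfl⟩ := hne
    rw [pairPath, Finset.insert_idem, Finset.card_insert_of_notMem]
    exact cons_notMem_pairPath rfl i rfl
  · rw [pairPath, Finset.card_insert_of_notMem, Finset.card_insert_of_notMem]
    · exact cons_notMem_pairPath h j h.symm
    · simp only [Finset.mem_insert, not_or]
      exact ⟨hne, cons_notMem_pairPath h i rfl⟩

/-- The mean of the offspring distribution. -/
noncomputable def offspringMean : ENNReal := ∫⁻ k, (k : ENNReal) ∂ζ.toMeasure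

/-- The second moment of the offspring distribution. -/
noncomputable def offspringSecond : ENNReal := ∫⁻ k, (k : ENNReal) ^ 2 ∂ζ.toMeasure

/-- The expected sum over the vertices at distance `h` from the root of the squared correlation with
the root, if `l` is the second moment of the correlation of an edge. -/
noncomputable def firstSum (l : ENNReal) (h : ℕ) : ENNReal :=
  ∫⁻ N, ∑ v ∈ level N h, l ^ (pairPath v v).card ∂treeLaw ζ

/-- The expected sum over the pairs of vertices at distance `h` from the root of the expected product
of the squared correlations of the edges on the paths to the root. -/
noncomputable def secondSum (l : ENNReal) (h : ℕ) : ENNReal :=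
  ∫⁻ N, ∑ v ∈ level N h, ∑ v' ∈ level N h, l ^ (pairPath v v').card ∂treeLaw ζ

instance : IsProbabilityMeasure (treeLaw ζ) := by unfold treeLaw; infer_instance

theorem firstSum_zero (l : ENNReal) : firstSum ζ l 0 = 1 := by
  simp [firstSum, level, pairPath]

theorem secondSum_zero (l : ENNReal) : secondSum ζ l 0 = 1 := by
  simp [secondSum, level, pairPath]

theorem measurable_first (l : ENNReal) (h : ℕ) :
    Measurable fun N : List ℕ → ℕ => ∑ v ∈ level N h, l ^ (pairPath v v).card :=
  measurable_sum_level (F := fun _ v => l ^ (pairPath v v).card) h fun _ => measurable_const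

theorem measurable_second (l : ENNReal) (h : ℕ) :
    Measurable fun N : List ℕ → ℕ =>
      ∑ v ∈ level N h, ∑ v' ∈ level N h, l ^ (pairPath v v').card :=
  measurable_sum_level (F := fun N v => ∑ v' ∈ level N h, l ^ (pairPath v v').card) h fun v =>
    measurable_sum_level (F := fun _ v' => l ^ (pairPath v v').card) h fun _ => measurable_const

theorem firstSum_succ (l : ENNReal) (h : ℕ) :
    firstSum ζ l (h + 1) = l * offspringMean ζ * firstSum ζ l h := by
  have h1 : ∀ N : List ℕ → ℕ, ∑ v ∈ level N (h + 1), l ^ (pairPath v v).card =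
      ∑ u ∈ level N h, l ^ (pairPath u u).card * l * (N u : ENNReal) := by
    intro N
    rw [sum_level_succ]
    refine Finset.sum_congr rfl fun u _ => ?_
    simp [card_pairPath_cons, pow_succ, mul_comm]
  have hm : ∀ u : List ℕ, Measurable fun N : List ℕ → ℕ => (N u : ENNReal) := fun u =>
    (measurable_from_top (f := fun k : ℕ => (k : ENNReal))).comp (measurable_pi_apply u)
  simp only [firstSum, h1]
  rw [lintegral_sum_level _ h fun u => (hm u).const_mul _,
    ← lintegral_const_mul _ (measurable_first l h)]
  simp only [Finset.mul_sum]
  rw [lintegral_sum_level (F := fun _ u => l * offspringMean ζ * l ^ (pairPath u u).card) _ h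
    fun u => measurable_const]
  refine tsum_congr fun u => ?_
  rw [lintegral_ite_level_mul ζ h u _ (fun k => (k : ENNReal))]
  refine lintegral_congr fun N => ?_
  split_ifs
  · rw [offspringMean]; ring
  · rfl

/-- Pairs of vertices are grouped by their parents. Distinct parents contribute `l ^ 2` times a
product of independent offspring numbers. A common parent with `n` children contributes at most `l *
n + l ^ 2 * n ^ 2`, counting `l + l ^ 2` instead of `l` for a repeated child. -/
theorem secondSum_succ_le (l : ENNReal) (h : ℕ) :
    secondSum ζ l (h + 1) ≤ (l * offspringMean ζ) ^ 2 * secondSum ζ l h +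
      (l * offspringMean ζ + l ^ 2 * offspringSecond ζ) * firstSum ζ l h := by
  -- `K` bounds the contribution of the children of `u` and `u'` in a given tree, and `K'` replaces
  -- offspring numbers by moments. On the diagonal `K'` has a surplus term, which completes its
  -- first part to a multiple of the full double sum.
  let K : (List ℕ → ℕ) → List ℕ → List ℕ → ENNReal := fun N u u' =>
    if u = u' then l ^ (pairPath u u).card * (l * (N u : ENNReal) + l ^ 2 * (N u : ENNReal) ^ 2)
    else l ^ (pairPath u u').card * l ^ 2 * (N u : ENNReal) * (N u' : ENNReal)
  let K' : List ℕ → List ℕ → ENNReal := fun u u' =>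
    (l * offspringMean ζ) ^ 2 * l ^ (pairPath u u').card + if u = u' then
      (l * offspringMean ζ + l ^ 2 * offspringSecond ζ) * l ^ (pairPath u u).card else 0
  have hm : ∀ u : List ℕ, Measurable fun N : List ℕ → ℕ => (N u : ENNReal) := fun u =>
    (measurable_from_top (f := fun k : ℕ => (k : ENNReal))).comp (measurable_pi_apply u)
  have hK : ∀ u u', Measurable fun N => K N u u' := by
    intro u u'
    by_cases huu : u = u'
    · simp only [K, huu, if_true]
      exact (((hm _).const_mul _).add (((hm _).pow_const 2).const_mul _)).const_mul _
    · simp only [K, huu, if_false]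
      exact ((hm _).const_mul _).mul (hm _)
  have h1 : ∀ N : List ℕ → ℕ, ∑ v ∈ level N (h + 1), ∑ v' ∈ level N (h + 1),
      l ^ (pairPath v v').card ≤ ∑ u ∈ level N h, ∑ u' ∈ level N h, K N u u' := by
    intro N
    simp only [sum_level_succ]
    refine Finset.sum_le_sum fun u hu => ?_
    rw [Finset.sum_comm]
    refine Finset.sum_le_sum fun u' hu' => ?_
    have hlen := (level_length N hu).trans (level_length N hu').symm
    by_cases huu : u = u'
    · subst huu
      simp only [K, if_true]
      calc ∑ i ∈ Finset.range (N u), ∑ j ∈ Finset.range (N u),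
            l ^ (pairPath (i :: u) (j :: u)).card
          ≤ ∑ i ∈ Finset.range (N u), ∑ j ∈ Finset.range (N u), l ^ (pairPath u u).card *
              ((if i = j then l else 0) + l ^ 2) := by
            refine Finset.sum_le_sum fun i _ => Finset.sum_le_sum fun j _ => ?_
            rw [card_pairPath_cons i j rfl, pow_add]
            refine mul_le_mul_right ?_ _
            by_cases hij : i = j <;> simp [hij]
        _ = _ := by
            simp only [← Finset.mul_sum, Finset.sum_add_distrib]
            congr 2
            · rw [Finset.sum_congr rfl fun i hi => (Finset.sum_ite_eq _ i _).trans (if_pos hi)]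
              simp [mul_comm]
            · simp only [Finset.sum_const, Finset.card_range, nsmul_eq_mul]; ring
    · simp only [K, if_neg huu]
      refine le_of_eq ?_
      have : ∀ i j, l ^ (pairPath (i :: u) (j :: u')).card = l ^ (pairPath u u').card * l ^ 2 := by
        intro i j
        rw [card_pairPath_cons i j hlen, if_neg (by simp [huu]), pow_add]
      simp only [this, Finset.sum_const, Finset.card_range, nsmul_eq_mul]
      ring
  have h2 : ∫⁻ N, ∑ u ∈ level N h, ∑ u' ∈ level N h, K' u u' ∂treeLaw ζ =
      (l * offspringMean ζ) ^ 2 * secondSum ζ l h +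
      (l * offspringMean ζ + l ^ 2 * offspringSecond ζ) * firstSum ζ l h := by
    rw [secondSum, firstSum, ← lintegral_const_mul _ (measurable_second l h),
      ← lintegral_const_mul _ (measurable_first l h),
      ← lintegral_add_right _ ((measurable_first l h).const_mul _)]
    refine lintegral_congr fun N => ?_
    simp only [K', Finset.sum_add_distrib, Finset.mul_sum]
    congr 1
    exact Finset.sum_congr rfl fun u hu => by rw [Finset.sum_ite_eq, if_pos hu]
  rw [secondSum, ← h2]
  refine (lintegral_mono h1).trans ?_
  rw [lintegral_sum_sum_level _ h hK, lintegral_sum_sum_level (F := fun _ => K') _ h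
    fun u u' => measurable_const]
  refine ENNReal.tsum_le_tsum fun u => ENNReal.tsum_le_tsum fun u' => ?_
  by_cases huu : u = u'
  · subst huu
    have h3 := lintegral_ite_level_mul ζ h u (l ^ (pairPath u u).card)
      (fun k => l * (k : ENNReal) + l ^ 2 * (k : ENNReal) ^ 2)
    rw [lintegral_add_left (measurable_from_top.const_mul _),
      lintegral_const_mul _ measurable_from_top, lintegral_const_mul _ measurable_from_top] at h3
    calc _ = ∫⁻ N, (if u ∈ level N h then l ^ (pairPath u u).card *
          (l * (N u : ENNReal) + l ^ 2 * (N u : ENNReal) ^ 2) else 0) ∂treeLaw ζ := by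
          refine lintegral_congr fun N => ?_
          by_cases hu : u ∈ level N h <;> simp [hu, K]
      _ ≤ _ := by
          rw [h3]
          refine lintegral_mono fun N => ?_
          by_cases hu : u ∈ level N h
          · simp only [hu, if_true, K']
            rw [mul_comm]
            exact le_add_self
          · simp [hu]
  -- Independence is only available for words of equal length; other pairs never lie in the level
  -- and contribute zero.
  · by_cases hlen : u.length = h ∧ u'.length = h
    · have h3 := lintegral_ite_level_mul_mul ζ h (hlen.1.trans hlen.2.symm) huu
        (l ^ (pairPath u u').card * l ^ 2) (fun k => (k : ENNReal))
      simp only [K, if_neg huu]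
      rw [h3]
      refine lintegral_mono fun N => ?_
      by_cases hu : u ∈ level N h <;> by_cases hu' : u' ∈ level N h <;>
        simp only [hu, hu', if_true, if_false, le_refl, K', huu, add_zero, offspringMean]
      refine le_of_eq ?_
      ring
    · have : ∀ N, (if u ∈ level N h then if u' ∈ level N h then K N u u' else 0 else 0) = 0 := by
        intro N
        by_cases hu : u ∈ level N h
        · have : u' ∉ level N h := fun hu' => hlen ⟨level_length N hu, level_length N hu'⟩
          simp [this]
        · simp [hu]
      simp [this]

end moments

/-! ### The two sides of the threshold -/

section thresholds

variable (β : ℝ) (ζ : PMF ℕ)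

theorem lintegral_first (N : List ℕ → ℕ) (h : ℕ) :
    ∫⁻ J : List ℕ → ℝ, ENNReal.ofReal (∑ v ∈ level N h, ∏ x ∈ pairPath v v, theta (β * J x) ^ 2)
      ∂(Measure.infinitePi fun _ : List ℕ => gaussianReal 0 1) =
      ∑ v ∈ level N h, edgeMoment β ^ (pairPath v v).card := by
  simp only [ENNReal.ofReal_sum_of_nonneg
    fun _ _ => Finset.prod_nonneg fun _ _ => sq_nonneg (theta _)]
  rw [lintegral_finsetSum _ fun v _ => measurable_prod_theta β _]
  simp only [lintegral_prod_theta]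

theorem measurable_sum_prod_theta (N : List ℕ → ℕ) (h : ℕ) :
    Measurable fun J : List ℕ → ℝ => ENNReal.ofReal
      (∑ v ∈ level N h, ∑ v' ∈ level N h, ∏ x ∈ pairPath v v', theta (β * J x) ^ 2) := by
  simp only [ENNReal.ofReal_sum_of_nonneg fun _ _ => Finset.sum_nonneg fun _ _ =>
      Finset.prod_nonneg fun _ _ => sq_nonneg (theta _),
    ENNReal.ofReal_sum_of_nonneg fun _ _ => Finset.prod_nonneg fun _ _ => sq_nonneg (theta _)]
  exact Finset.measurable_sum _ fun v _ => Finset.measurable_sum _ fun v' _ =>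
    measurable_prod_theta β _

theorem lintegral_second (N : List ℕ → ℕ) (h : ℕ) :
    ∫⁻ J : List ℕ → ℝ, ENNReal.ofReal
      (∑ v ∈ level N h, ∑ v' ∈ level N h, ∏ x ∈ pairPath v v', theta (β * J x) ^ 2)
      ∂(Measure.infinitePi fun _ : List ℕ => gaussianReal 0 1) =
      ∑ v ∈ level N h, ∑ v' ∈ level N h, edgeMoment β ^ (pairPath v v').card := by
  simp only [ENNReal.ofReal_sum_of_nonneg fun _ _ => Finset.sum_nonneg fun _ _ =>
      Finset.prod_nonneg fun _ _ => sq_nonneg (theta _),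
    ENNReal.ofReal_sum_of_nonneg fun _ _ => Finset.prod_nonneg fun _ _ => sq_nonneg (theta _)]
  rw [lintegral_finsetSum _ fun v _ => Finset.measurable_sum _ fun v' _ =>
    measurable_prod_theta β _]
  refine Finset.sum_congr rfl fun v _ => ?_
  rw [lintegral_finsetSum _ fun v' _ => measurable_prod_theta β _]
  simp only [lintegral_prod_theta]

theorem expectedTV_le (h : ℕ) {ε : ℝ} (hε : 0 < ε) :
    expectedTV β ζ h ≤ ENNReal.ofReal (ε / 2) +
      ENNReal.ofReal (ε⁻¹ / 2) * firstSum ζ (edgeMoment β) h := by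
  have h1 : ∀ N : List ℕ → ℕ, ∫⁻ J : List ℕ → ℝ, ENNReal.ofReal (tvDist β N J h)
      ∂(Measure.infinitePi fun _ : List ℕ => gaussianReal 0 1) ≤ ENNReal.ofReal (ε / 2) +
      ENNReal.ofReal (ε⁻¹ / 2) * ∑ v ∈ level N h, edgeMoment β ^ (pairPath v v).card := by
    intro N
    calc _ ≤ ∫⁻ J : List ℕ → ℝ, (ENNReal.ofReal (ε / 2) + ENNReal.ofReal (ε⁻¹ / 2) *
          ENNReal.ofReal (∑ v ∈ level N h, ∏ x ∈ pairPath v v, theta (β * J x) ^ 2))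
          ∂(Measure.infinitePi fun _ : List ℕ => gaussianReal 0 1) := by
          refine lintegral_mono fun J => ?_
          rw [← ENNReal.ofReal_mul (by positivity), ← ENNReal.ofReal_add (by positivity)
            (mul_nonneg (by positivity) (Finset.sum_nonneg fun _ _ =>
              Finset.prod_nonneg fun _ _ => sq_nonneg _))]
          refine ENNReal.ofReal_le_ofReal ((tvDist_le β N J h hε).trans (le_of_eq ?_))
          rw [pathSum_nil]
          ring
      _ = _ := by
          rw [lintegral_add_left measurable_const, lintegral_const,
            lintegral_const_mul' _ _ ENNReal.ofReal_ne_top, lintegral_first]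
          simp
  calc _ ≤ ∫⁻ N, (ENNReal.ofReal (ε / 2) + ENNReal.ofReal (ε⁻¹ / 2) *
        ∑ v ∈ level N h, edgeMoment β ^ (pairPath v v).card) ∂treeLaw ζ := lintegral_mono h1
    _ = _ := by
        rw [lintegral_add_left measurable_const, lintegral_const,
          lintegral_const_mul' _ _ ENNReal.ofReal_ne_top, firstSum]
        simp

theorem le_expectedTV (h : ℕ) {t : ℝ} (ht : 0 ≤ t) :
    ENNReal.ofReal (2 * t) * firstSum ζ (edgeMoment β) h ≤
      expectedTV β ζ h + ENNReal.ofReal (t ^ 2) * secondSum ζ (edgeMoment β) h := by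
  have h1 : ∀ N : List ℕ → ℕ,
      ENNReal.ofReal (2 * t) * ∑ v ∈ level N h, edgeMoment β ^ (pairPath v v).card ≤
      ∫⁻ J : List ℕ → ℝ, ENNReal.ofReal (tvDist β N J h)
        ∂(Measure.infinitePi fun _ : List ℕ => gaussianReal 0 1) +
      ENNReal.ofReal (t ^ 2) * ∑ v ∈ level N h, ∑ v' ∈ level N h,
        edgeMoment β ^ (pairPath v v').card := by
    intro N
    -- The integral is split using measurability of the second summand only, so none is needed for
    -- `tvDist`.
    rw [← lintegral_first, ← lintegral_second, ← lintegral_const_mul' _ _ ENNReal.ofReal_ne_top,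
      ← lintegral_const_mul' _ _ ENNReal.ofReal_ne_top,
      ← lintegral_add_right _ ((measurable_sum_prod_theta β N h).const_mul _)]
    refine lintegral_mono fun J => ?_
    have hTV : 0 ≤ tvDist β N J h :=
      mul_nonneg (by norm_num) (Finset.sum_nonneg fun _ _ => abs_nonneg _)
    rw [← ENNReal.ofReal_mul (by positivity), ← ENNReal.ofReal_mul (by positivity),
      ← ENNReal.ofReal_add hTV (mul_nonneg (by positivity) (Finset.sum_nonneg fun _ _ =>
        Finset.sum_nonneg fun _ _ => Finset.prod_nonneg fun _ _ => sq_nonneg _))]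
    exact ENNReal.ofReal_le_ofReal (le_tvDist β N J h t)
  calc _ = ∫⁻ N, ENNReal.ofReal (2 * t) *
        ∑ v ∈ level N h, edgeMoment β ^ (pairPath v v).card ∂treeLaw ζ := by
        rw [lintegral_const_mul' _ _ ENNReal.ofReal_ne_top, firstSum]
    _ ≤ _ := lintegral_mono h1
    _ = _ := by
        rw [lintegral_add_right _ ((measurable_second _ h).const_mul _),
          lintegral_const_mul' _ _ ENNReal.ofReal_ne_top, secondSum]
        rfl

theorem firstSum_eq {m : ℝ} (hm : 0 ≤ m)
    (hm' : edgeMoment β * offspringMean ζ = ENNReal.ofReal m) (h : ℕ) :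
    firstSum ζ (edgeMoment β) h = ENNReal.ofReal (m ^ h) := by
  induction h with
  | zero => simp [firstSum_zero]
  | succ h ih => rw [firstSum_succ, ih, hm', ← ENNReal.ofReal_mul hm, pow_succ']

theorem nonReconstruction_of_lt_one {m : ℝ} (hm : 0 ≤ m) (hm1 : m < 1)
    (hm' : edgeMoment β * offspringMean ζ = ENNReal.ofReal m) : NonReconstruction β ζ := by
  refine le_antisymm (ENNReal.le_of_forall_pos_le_add fun ε hε _ => ?_) zero_le
  have hε' : (0 : ℝ) < ε := hε
  rw [zero_add]
  refine limsup_le_of_le (by isBoundedDefault) ?_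
  have hlim : Tendsto (fun h : ℕ => (ε : ℝ) / 2 + (ε : ℝ)⁻¹ / 2 * m ^ h) atTop
      (nhds ((ε : ℝ) / 2 + (ε : ℝ)⁻¹ / 2 * 0)) :=
    ((tendsto_pow_atTop_nhds_zero_of_lt_one hm hm1).const_mul _).const_add _
  filter_upwards [hlim.eventually (gt_mem_nhds (show (ε : ℝ) / 2 + (ε : ℝ)⁻¹ / 2 * 0 < ε by
    linarith))] with h hh
  refine (expectedTV_le β ζ h hε').trans ?_
  rw [firstSum_eq β ζ hm hm', ← ENNReal.ofReal_mul (by positivity),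
    ← ENNReal.ofReal_add (by positivity) (by positivity)]
  exact (ENNReal.ofReal_le_ofReal hh.le).trans (by simp)

/-- The bound solves a(h+1) = m²a(h) + c·m^h with a(0) = 1 exactly. The coefficient K of -m^h is
fixed by Km² - c = Km; dropping that term from the outset would break the induction. -/
theorem secondSum_le {m c : ℝ} (hm1 : 1 < m) (hc : 0 ≤ c)
    (hm' : edgeMoment β * offspringMean ζ = ENNReal.ofReal m)
    (hc' : edgeMoment β * offspringMean ζ + edgeMoment β ^ 2 * offspringSecond ζ =
      ENNReal.ofReal c) (h : ℕ) :
    secondSum ζ (edgeMoment β) h ≤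
      ENNReal.ofReal ((1 + c / (m * (m - 1))) * m ^ (2 * h) - c / (m * (m - 1)) * m ^ h) := by
  have hm0 : 0 < m := by linarith
  have hm2 : 0 < m - 1 := by linarith
  induction h with
  | zero => simp [secondSum_zero]
  | succ h ih =>
    have hpow : m ^ h ≤ m ^ (2 * h) := pow_le_pow_right₀ hm1.le (by omega)
    have hK : 0 ≤ c / (m * (m - 1)) := by positivity
    refine (secondSum_succ_le ζ (edgeMoment β) h).trans ?_
    rw [hc', hm', firstSum_eq β ζ hm0.le hm', ← ENNReal.ofReal_pow hm0.le,
      ← ENNReal.ofReal_mul hc]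
    refine (add_le_add_left (mul_le_mul_right ih _) _).trans (le_of_eq ?_)
    rw [← ENNReal.ofReal_mul (by positivity), ← ENNReal.ofReal_add
      (mul_nonneg (by positivity) (by nlinarith [pow_pos hm0 (2 * h)])) (by positivity)]
    congr 1
    rw [show 2 * (h + 1) = 2 * h + 2 by ring, pow_add m (2 * h), pow_succ m h]
    field_simp
    ring

theorem reconstruction_of_one_lt {m c : ℝ} (hm1 : 1 < m) (hc : 0 ≤ c)
    (hm' : edgeMoment β * offspringMean ζ = ENNReal.ofReal m)
    (hc' : edgeMoment β * offspringMean ζ + edgeMoment β ^ 2 * offspringSecond ζ =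
      ENNReal.ofReal c) : Reconstruction β ζ := by
  have hm0 : 0 < m := by linarith
  have hm2 : 0 < m - 1 := by linarith
  set C : ℝ := 1 + c / (m * (m - 1)) with hC
  have hC0 : 0 < C := by positivity
  have key : ∀ h, ENNReal.ofReal C⁻¹ ≤ expectedTV β ζ h := by
    intro h
    have hp : 0 < m ^ h := by positivity
    -- This `t` maximises 2t·m^h - t²·C·m^(2h), with maximum 1/C.
    have h1 := le_expectedTV β ζ h (t := (C * m ^ h)⁻¹) (by positivity)
    have h2 : secondSum ζ (edgeMoment β) h ≤ ENNReal.ofReal (C * m ^ (2 * h)) :=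
      (secondSum_le β ζ hm1 hc hm' hc' h).trans (ENNReal.ofReal_le_ofReal
        (sub_le_self _ (by positivity)))
    replace h1 := h1.trans (add_le_add_right (mul_le_mul_right h2 _) _)
    rw [firstSum_eq β ζ hm0.le hm', ← ENNReal.ofReal_mul (by positivity),
      ← ENNReal.ofReal_mul (by positivity)] at h1
    have e1 : 2 * (C * m ^ h)⁻¹ * m ^ h = C⁻¹ + C⁻¹ := by field_simp; norm_num
    have e2 : (C * m ^ h)⁻¹ ^ 2 * (C * m ^ (2 * h)) = C⁻¹ := by
      rw [mul_comm 2 h, pow_mul]; field_simp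
    rw [e1, e2, ENNReal.ofReal_add (by positivity) (by positivity)] at h1
    exact ENNReal.le_of_add_le_add_right ENNReal.ofReal_ne_top h1
  have h1 : ENNReal.ofReal C⁻¹ ≤ limsup (expectedTV β ζ) atTop :=
    le_trans (le_liminf_of_le (by isBoundedDefault) (Eventually.of_forall key)) liminf_le_limsup
  exact (ENNReal.ofReal_pos.2 (by positivity)).trans_le h1

theorem lintegral_offspring {f : ℕ → ℝ} (hf : ∀ k, 0 ≤ f k) {s : ℝ}
    (hs : HasSum (fun k => f k * (ζ k).toReal) s) :
    ∫⁻ k, ENNReal.ofReal (f k) ∂ζ.toMeasure = ENNReal.ofReal s := by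
  rw [lintegral_countable', ← hs.tsum_eq, ENNReal.ofReal_tsum_of_nonneg
    (fun k => mul_nonneg (hf k) ENNReal.toReal_nonneg) hs.summable]
  refine tsum_congr fun k => ?_
  rw [PMF.toMeasure_apply_singleton _ _ (MeasurableSet.singleton k), ENNReal.ofReal_mul (hf k),
    ENNReal.ofReal_toReal (PMF.apply_ne_top ζ k)]

theorem integrable_theta_sq :
    Integrable (fun y => theta (β * y) ^ 2) (gaussianReal 0 1) := by
  refine Integrable.of_bound
    ((measurable_theta.comp (measurable_const_mul β)).pow_const 2).aestronglyMeasurable 1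
    (Eventually.of_forall fun y => ?_)
  rw [Real.norm_eq_abs, abs_of_nonneg (sq_nonneg _)]
  exact (sq_le_one_iff_abs_le_one _).2 (abs_theta_lt _).le

theorem deltaEA_eq : deltaEA β = (∫ y, theta (β * y) ^ 2 ∂(gaussianReal 0 1))⁻¹ := by
  rw [deltaEA]
  congr 2
  funext y
  rw [theta, div_pow, div_pow, add_comm (1 : ℝ), ← neg_sub, neg_sq]

theorem edgeMoment_eq : edgeMoment β = ENNReal.ofReal (deltaEA β)⁻¹ := by
  rw [edgeMoment, ← ofReal_integral_eq_lintegral_ofReal (integrable_theta_sq β)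
    (Eventually.of_forall fun y => sq_nonneg _), deltaEA_eq, inv_inv]

/-- The correlation vanishes only at coupling 0, which is a null set for the Gaussian, so the
inverted integral is not 0. -/
theorem deltaEA_pos {β : ℝ} (hβ : 0 < β) : 0 < deltaEA β := by
  have h1 : 0 < ∫ y, theta (β * y) ^ 2 ∂(gaussianReal 0 1) := by
    rw [integral_pos_iff_support_of_nonneg (fun y => sq_nonneg _) (integrable_theta_sq β)]
    have hsub : ({0} : Set ℝ)ᶜ ⊆ Function.support fun y => theta (β * y) ^ 2 := by
      intro y hy
      have h2 : Real.exp (β * y) ≠ 1 := by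
        rw [Ne, Real.exp_eq_one_iff]
        exact mul_ne_zero hβ.ne' hy
      have h3 : Real.exp (β * y) + 1 ≠ 0 := by positivity
      exact pow_ne_zero 2 (div_ne_zero (sub_ne_zero.2 h2) h3)
    have := nullSingletonClass_gaussianReal (μ := 0) (v := 1) one_ne_zero
    refine lt_of_lt_of_le ?_ (measure_mono hsub)
    rw [prob_compl_eq_one_sub (MeasurableSet.singleton _), measure_singleton]
    simp
  rwa [deltaEA_eq, inv_pos]

end thresholds

end EAModel

theorem corollary2 (β : ℝ) (hβ : 0 < β) (d : ℝ) (hd : 0 < d) (ζ : PMF ℕ)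
    (hmean : HasSum (fun k : ℕ => (k : ℝ) * (ζ k).toReal) d)
    (hsecond : Summable (fun k : ℕ => (k : ℝ) ^ 2 * (ζ k).toReal)) :
    (EAModel.deltaEA β < d → EAModel.Reconstruction β ζ) ∧
      (d < EAModel.deltaEA β → EAModel.NonReconstruction β ζ) := by
  have hΔ := EAModel.deltaEA_pos hβ
  have hl := EAModel.edgeMoment_eq β
  have h1 : EAModel.offspringMean ζ = ENNReal.ofReal d := by
    simpa [EAModel.offspringMean] using
      EAModel.lintegral_offspring ζ (fun k => Nat.cast_nonneg k) hmean
  have h2 : EAModel.offspringSecond ζ =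
      ENNReal.ofReal (∑' k : ℕ, (k : ℝ) ^ 2 * (ζ k).toReal) := by
    simpa [EAModel.offspringSecond, ENNReal.ofReal_pow] using
      EAModel.lintegral_offspring ζ (fun k => sq_nonneg (k : ℝ)) hsecond.hasSum
  have hs : 0 ≤ ∑' k : ℕ, (k : ℝ) ^ 2 * (ζ k).toReal :=
    tsum_nonneg fun k => mul_nonneg (sq_nonneg _) ENNReal.toReal_nonneg
  have hm : EAModel.edgeMoment β * EAModel.offspringMean ζ =
      ENNReal.ofReal ((EAModel.deltaEA β)⁻¹ * d) := by
    rw [hl, h1, ← ENNReal.ofReal_mul (by positivity)]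
  constructor
  · intro hlt
    refine EAModel.reconstruction_of_one_lt β ζ (m := (EAModel.deltaEA β)⁻¹ * d)
      (c := (EAModel.deltaEA β)⁻¹ * d +
        (EAModel.deltaEA β)⁻¹ ^ 2 * ∑' k : ℕ, (k : ℝ) ^ 2 * (ζ k).toReal) ?_ (by positivity) hm ?_
    · rwa [inv_mul_eq_div, one_lt_div hΔ]
    · rw [hm, hl, h2, ← ENNReal.ofReal_pow (by positivity), ← ENNReal.ofReal_mul (by positivity),
        ← ENNReal.ofReal_add (by positivity) (by positivity)]
  · intro hlt
    refine EAModel.nonReconstruction_of_lt_one β ζ (m := (EAModel.deltaEA β)⁻¹ * d)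
      (by positivity) ?_ hm
    rwa [inv_mul_eq_div, div_lt_one hΔ]
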